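/- Let $X$ be a simply connected closed (compact, without boundary) smooth $4$-manifold and $f\colon X\to X$ a smooth diffeomorphism. Let $k\ge 0$, $A\in SL(k,\mathbb Z)$, and assume: (1) $\pi_2(X)$ is a free abelian group of finite rank $m\ge k$, and it splits as $\mathbb Z^k\oplus\mathbb Z^{m-k}$ in such a way that the first summand is $\pi_2(f)$-invariant and $\pi_2(f)|_{\mathbb Z^k}$ is represented by the matrix $A$. (As $X$ is simply connected, $\pi_2(X)$ and $\pi_2(f)$ do not depend on base points.) (2) There are an $A$-invariant splitting $\mathbb R^k=E^s_A\oplus E^c_A\oplus E^u_A$ with $E^s_A\ne 0$ and $E^u_A\ne 0$ ($E^c_A=0$ is allowed) and a smooth Riemannian metric $\|\cdot\|$ on $X$ such that the numbers $$\lambda_\sigma=\min_{v\in E^\sigma_A,\ \|v\|=1}\|Av\|,\qquad \mu_\sigma=\max_{v\in E^\sigma_A,\ \|v\|=1}\|Av\|,\qquad \sigma=s,c,u$$ (Euclidean norm on $\mathbb R^k$) satisfy $$\lambda_s\le\mu_s<\lambda_c\le\mu_c<\lambda_u\le\mu_u,\qquad \mu_s<\min_{v\in TX,\ \|v\|=1}\|Df(v)\|,\qquad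 \lambda_u>\max_{v\in TX,\ \|v\|=1}\|Df(v)\|.$$ If $E^c_A=0$, the first chain is to be read as $\lambda_s\le\mu_s<\lambda_u\le\mu_u$. Let $\pi\colon E\to X$ be a smooth principal $\mathbb T^k$-bundle and let $F\colon E\to E$ be a smooth $A$-map over $f$, that is, $\pi\circ F=f\circ\pi$ and $F(y.g)=F(y).A(g)$ for all $y\in E$, $g\in\mathbb T^k$, where $A$ also denotes the induced automorphism of $\mathbb T^k=\mathbb R^k/\mathbb Z^k$. For $\sigma=s,c,u$ let $E^\sigma\subset TE$ be the subbundle tangent to the torus fibers given by $E^\sigma(y)=\{\frac{d}{dt}|_{t=0}\, y.[tv] : v\in E^\sigma_A\}$, where $[\cdot]\colon\mathbb R^k\to\mathbb T^k$ is the projection. Then $F$ is a partially hyperbolic diffeomorphism. More precisely, $F$ is a diffeomorphism and there is a continuous subbundle $H'\subset TE$ complementary to the bundle $\ker D\pi$ of vectors tangent to the fibers, such that $F$ is partially hyperbolic with stable bundle $E^s$, center bundle $E^c\oplus H'$ and unstable bundle $E^u$. Here a diffeomorphism $F$ of a manifold $M$ is called partially hyperbolic with stable, center and unstable bundles $S$,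 $C$, $U$ if $TM=S\oplus C\oplus U$ is a $DF$-invariant splitting into continuous subbundles with $S\ne0$ and $U\ne0$ and there are a constant $\lambda>1$ and a smooth Riemannian metric on $M$ such that for all unit vectors $v^s\in S$, $v^c\in C$, $v^u\in U$ (possibly at different points of $M$) $$\|DF(v^s)\|\le\lambda^{-1},\qquad \|DF(v^s)\|<\|DF(v^c)\|<\|DF(v^u)\|,\qquad \lambda\le\|DF(v^u)\|.$$ -/

import Mathlib

open scoped Manifold ContDiff Topology Topology.Homotopy

noncomputable section

namespace TorusExt

universe u v

/-! ### The torus and its automorphisms -/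

/-- The torus `𝕋ᵏ = S¹ × ⋯ × S¹`, with the product topology, group and manifold structure. -/
abbrev Torus (k : ℕ) : Type := Fin k → Circle

/-- The model with corners of the product manifold `𝕋ᵏ = S¹ × ⋯ × S¹`. -/
abbrev torusModel (k : ℕ) :
    ModelWithCorners ℝ (Fin k → EuclideanSpace ℝ (Fin 1))
      (ModelPi fun _ : Fin k => EuclideanSpace ℝ (Fin 1)) :=
  ModelWithCorners.pi fun _ : Fin k => 𝓡 1

/-- The covering homomorphism `ℝᵏ → 𝕋ᵏ`, `v ↦ (exp (2πi vⱼ))ⱼ`, with kernel `ℤᵏ`. -/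
def torusExp (k : ℕ) (v : EuclideanSpace ℝ (Fin k)) : Torus k :=
  fun j => Circle.exp (2 * Real.pi * v j)

/-- The automorphism of `𝕋ᵏ` given by an integer matrix: `(A g)ᵢ = ∏ⱼ gⱼ ^ Aᵢⱼ`. -/
def torusAut {k : ℕ} (A : Matrix.SpecialLinearGroup (Fin k) ℤ) (g : Torus k) : Torus k :=
  fun i => ∏ j, g j ^ (A.1 i j)

/-- The linear automorphism of Euclidean `ℝᵏ` given by an integer matrix. -/
def realLin {k : ℕ} (A : Matrix.SpecialLinearGroup (Fin k) ℤ) :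
    EuclideanSpace ℝ (Fin k) →ₗ[ℝ] EuclideanSpace ℝ (Fin k) :=
  Matrix.toEuclideanLin (A.1.map (Int.cast : ℤ → ℝ))

/-- `min ‖A v‖` over unit vectors `v` in the subspace `V` (meaningful for `V ≠ 0`). -/
def linMin {k : ℕ} (A : Matrix.SpecialLinearGroup (Fin k) ℤ)
    (V : Submodule ℝ (EuclideanSpace ℝ (Fin k))) : ℝ :=
  sInf {r | ∃ v ∈ V, ‖v‖ = 1 ∧ r = ‖realLin A v‖}

/-- `max ‖A v‖` over unit vectors `v` in the subspace `V` (meaningful for `V ≠ 0`). -/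
def linMax {k : ℕ} (A : Matrix.SpecialLinearGroup (Fin k) ℤ)
    (V : Submodule ℝ (EuclideanSpace ℝ (Fin k))) : ℝ :=
  sSup {r | ∃ v ∈ V, ‖v‖ = 1 ∧ r = ‖realLin A v‖}

/-- The ambient space is the internal direct sum of three subspaces. -/
def IsSplitting {V : Type*} [AddCommGroup V] [Module ℝ V] (Es Ec Eu : Submodule ℝ V) : Prop :=
  Disjoint Es Ec ∧ IsCompl (Es ⊔ Ec) Eu

/-! ### The action on the second homotopy group -/

/-- Free homotopy of two spheroids `Iⁿ → X` with possibly different base points: a homotopy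
through maps that are constant on the boundary of the cube. In a simply connected space this is
the relation given by the canonical identification of the homotopy groups at different
base points. -/
def FreelyHomotopic {n : ℕ} {X : Type u} [TopologicalSpace X] {x y : X}
    (γ : Ω^ (Fin n) X x) (δ : Ω^ (Fin n) X y) : Prop :=
  ∃ H : C(unitInterval × (Fin n → unitInterval), X),
    (∀ z, H (0, z) = γ z) ∧ (∀ z, H (1, z) = δ z) ∧
    ∀ t, ∀ z ∈ Cube.boundary (Fin n), ∀ w ∈ Cube.boundary (Fin n), H (t, z) = H (t, w)

/-- The spheroid `f ∘ γ`, based at `f x`. -/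
def spheroidMap {n : ℕ} {X : Type u} [TopologicalSpace X] {x : X} (f : C(X, X))
    (γ : Ω^ (Fin n) X x) : Ω^ (Fin n) X (f x) :=
  ⟨f.comp γ.1, fun z hz => congrArg f (γ.2 z hz)⟩

/-- `φ` is the endomorphism `π₂(f)` of `π₂(X, x)` induced by a self-map `f` of a simply connected
space, where `π₂(X, f x)` is identified with `π₂(X, x)` by free homotopy. -/
def IsPiTwoMap {X : Type u} [TopologicalSpace X] (f : C(X, X)) (x : X)
    (φ : π_ 2 X x →* π_ 2 X x) : Prop :=
  ∀ γ δ : Ω^ (Fin 2) X x,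
    φ (Quotient.mk _ γ : π_ 2 X x) = (Quotient.mk _ δ : π_ 2 X x) →
      FreelyHomotopic (spheroidMap f γ) δ

/-- `π₂(X, x)` is free abelian of finite rank and splits as `ℤᵏ ⊕ ℤˡ` in such a way that `π₂(f)`
preserves the first summand and is given on it by the matrix `A`. -/
def HasPiTwoSplitting {k : ℕ} {X : Type u} [TopologicalSpace X] (f : C(X, X)) (x : X)
    (A : Matrix.SpecialLinearGroup (Fin k) ℤ) : Prop :=
  ∃ (φ : π_ 2 X x →* π_ 2 X x) (l : ℕ)
    (e : π_ 2 X x ≃* Multiplicative ((Fin k → ℤ) × (Fin l → ℤ))),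
    IsPiTwoMap f x φ ∧
    ∀ w : Fin k → ℤ, φ (e.symm (Multiplicative.ofAdd (w, 0))) =
      e.symm (Multiplicative.ofAdd (A.1.mulVec w, 0))

/-! ### Riemannian metrics, subbundles, partial hyperbolicity -/

section Manifold

variable {n : ℕ} {M : Type u} [TopologicalSpace M] [ChartedSpace (EuclideanSpace ℝ (Fin n)) M]

/-- A smooth Riemannian metric on a smooth `n`-manifold. -/
abbrev Metric (n : ℕ) (M : Type u) [TopologicalSpace M]
    [ChartedSpace (EuclideanSpace ℝ (Fin n)) M] [IsManifold (𝓡 n) ∞ M] : Type u :=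
  Bundle.ContMDiffRiemannianMetric (𝓡 n) ∞ (EuclideanSpace ℝ (Fin n))
    (fun x : M => TangentSpace (𝓡 n) x)

/-- The length of a tangent vector. -/
def Metric.len [IsManifold (𝓡 n) ∞ M] (g : Metric n M) {x : M} (v : TangentSpace (𝓡 n) x) : ℝ :=
  √(g.inner x v v)

/-- `m(f)`, the minimum of `‖Df v‖` over all unit tangent vectors `v`. -/
def Metric.derivMin [IsManifold (𝓡 n) ∞ M] (g : Metric n M) (f : M → M) : ℝ :=
  sInf {r | ∃ (x : M) (v : TangentSpace (𝓡 n) x), g.len v = 1 ∧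
    r = g.len (mfderiv (𝓡 n) (𝓡 n) f x v)}

/-- `‖Df‖`, the maximum of `‖Df v‖` over all unit tangent vectors `v`. -/
def Metric.derivMax [IsManifold (𝓡 n) ∞ M] (g : Metric n M) (f : M → M) : ℝ :=
  sSup {r | ∃ (x : M) (v : TangentSpace (𝓡 n) x), g.len v = 1 ∧
    r = g.len (mfderiv (𝓡 n) (𝓡 n) f x v)}

/-- A family of subspaces of the tangent spaces is a (continuous) subbundle of the tangent bundle:
locally it is spanned by finitely many continuous, pointwise linearly independent vector fields. -/
def IsSubbundle [IsManifold (𝓡 n) ∞ M] (V : ∀ x : M, Submodule ℝ (TangentSpace (𝓡 n) x)) :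
    Prop :=
  ∀ x₀ : M, ∃ U ∈ 𝓝 x₀, ∃ (r : ℕ) (s : Fin r → ∀ x : M, TangentSpace (𝓡 n) x),
    (∀ i, ContinuousOn (fun x => (⟨x, s i x⟩ : TangentBundle (𝓡 n) M)) U) ∧
    ∀ x ∈ U, LinearIndependent ℝ (fun i => s i x) ∧
      Submodule.span ℝ (Set.range fun i => s i x) = V x

/-- The family of subspaces is invariant under the derivative of `F`. -/
def IsInvariantFamily (F : M → M) (V : ∀ x : M, Submodule ℝ (TangentSpace (𝓡 n) x)) : Prop :=
  ∀ x, (V x).map (mfderiv (𝓡 n) (𝓡 n) F x).toLinearMap = V (F x)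

/-- `F` is partially hyperbolic with stable, center and unstable subbundles `Es`, `Ec`, `Eu`.
The stable and unstable bundles are nonzero, the center bundle may be zero. -/
structure IsPartiallyHyperbolicFor [IsManifold (𝓡 n) ∞ M] (F : M ≃ₘ^∞⟮𝓡 n, 𝓡 n⟯ M)
    (Es Ec Eu : ∀ x : M, Submodule ℝ (TangentSpace (𝓡 n) x)) : Prop where
  subbundle_s : IsSubbundle Es
  subbundle_c : IsSubbundle Ec
  subbundle_u : IsSubbundle Eu
  splitting : ∀ x, IsSplitting (Es x) (Ec x) (Eu x)
  nonzero_s : ∀ x, Es x ≠ ⊥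
  nonzero_u : ∀ x, Eu x ≠ ⊥
  invariant_s : IsInvariantFamily F Es
  invariant_c : IsInvariantFamily F Ec
  invariant_u : IsInvariantFamily F Eu
  /-- The inequalities hold for unit vectors at arbitrary, possibly different, points. -/
  domination : ∃ (lam : ℝ) (g : Metric n M), 1 < lam ∧
    (∀ (x : M), ∀ v ∈ Es x, g.len v = 1 →
      g.len (mfderiv (𝓡 n) (𝓡 n) F x v) ≤ lam⁻¹) ∧
    (∀ (x y : M), ∀ v ∈ Es x, ∀ w ∈ Ec y, g.len v = 1 → g.len w = 1 →
      g.len (mfderiv (𝓡 n) (𝓡 n) F x v) < g.len (mfderiv (𝓡 n) (𝓡 n) F y w)) ∧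
    (∀ (x y : M), ∀ v ∈ Ec x, ∀ w ∈ Eu y, g.len v = 1 → g.len w = 1 →
      g.len (mfderiv (𝓡 n) (𝓡 n) F x v) < g.len (mfderiv (𝓡 n) (𝓡 n) F y w)) ∧
    (∀ (x : M), ∀ v ∈ Eu x, g.len v = 1 →
      lam ≤ g.len (mfderiv (𝓡 n) (𝓡 n) F x v))

/-- `F` is a partially hyperbolic diffeomorphism. -/
def IsPartiallyHyperbolic [IsManifold (𝓡 n) ∞ M] (F : M ≃ₘ^∞⟮𝓡 n, 𝓡 n⟯ M) : Prop :=
  ∃ Es Ec Eu : ∀ x : M, Submodule ℝ (TangentSpace (𝓡 n) x), IsPartiallyHyperbolicFor F Es Ec Eu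

end Manifold

/-! ### The assumptions on the base diffeomorphism -/

/-- The standing assumptions on a diffeomorphism `f` of a closed simply connected 4-manifold, with
matrix `A` and `A`-invariant splitting `ℝᵏ = Es ⊕ Ec ⊕ Eu`. Only `Ec` is allowed to be zero, in
which case the inequalities that involve it are void. -/
structure BaseAssumptions {k : ℕ} {X : Type u} [TopologicalSpace X]
    [ChartedSpace (EuclideanSpace ℝ (Fin 4)) X] [IsManifold (𝓡 4) ∞ X]
    (f : X ≃ₘ^∞⟮𝓡 4, 𝓡 4⟯ X) (A : Matrix.SpecialLinearGroup (Fin k) ℤ)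
    (Es Ec Eu : Submodule ℝ (EuclideanSpace ℝ (Fin k))) : Prop where
  pi_two : ∃ x : X, HasPiTwoSplitting (f.toHomeomorph : C(X, X)) x A
  splitting : IsSplitting Es Ec Eu
  nonzero_s : Es ≠ ⊥
  nonzero_u : Eu ≠ ⊥
  invariant_s : Es.map (realLin A) = Es
  invariant_c : Ec.map (realLin A) = Ec
  invariant_u : Eu.map (realLin A) = Eu
  s_lt_u : linMax A Es < linMin A Eu
  s_lt_c : Ec ≠ ⊥ → linMax A Es < linMin A Ec
  c_lt_u : Ec ≠ ⊥ → linMax A Ec < linMin A Eu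
  domination : ∃ g : Metric 4 X, linMax A Es < g.derivMin f ∧ g.derivMax f < linMin A Eu

/-! ### Principal torus bundles and `A`-maps -/

section Bundle

variable {k b d : ℕ} {X : Type u} {E : Type v}
  [TopologicalSpace X] [ChartedSpace (EuclideanSpace ℝ (Fin b)) X]
  [TopologicalSpace E] [ChartedSpace (EuclideanSpace ℝ (Fin d)) E] [MulAction (Torus k) E]

/-- `p : E → X` is a smooth principal `𝕋ᵏ`-bundle: `𝕋ᵏ` acts smoothly on `E` preserving the fibers
of `p`, and over a neighbourhood of each point of `X` there is a smooth trivialization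
`p⁻¹ U ≃ U × 𝕋ᵏ` that intertwines the action with translations. (As `𝕋ᵏ` is abelian, left and
right actions are the same.) -/
structure IsPrincipalTorusBundle (p : E → X) : Prop where
  contMDiff_proj : ContMDiff (𝓡 d) (𝓡 b) ∞ p
  contMDiff_smul : ContMDiffSMul (torusModel k) (𝓡 d) ∞ (Torus k) E
  proj_smul : ∀ (t : Torus k) (y : E), p (t • y) = p y
  exists_trivialization : ∀ x : X, ∃ e : Bundle.Trivialization (Torus k) p, x ∈ e.baseSet ∧
    ContMDiffOn (𝓡 d) ((𝓡 b).prod (torusModel k)) ∞ e e.source ∧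
    ContMDiffOn ((𝓡 b).prod (torusModel k)) (𝓡 d) ∞ e.toOpenPartialHomeomorph.symm e.target ∧
    ∀ (t : Torus k), ∀ y ∈ e.source, e (t • y) = ((e y).1, (e y).2 * t)

/-- `F` is a smooth `A`-map over `f`: it covers `f` and `F (y.g) = F(y).A(g)`. -/
structure IsAMap (A : Matrix.SpecialLinearGroup (Fin k) ℤ) (p : E → X) (f : X → X)
    (F : E → E) : Prop where
  contMDiff : ContMDiff (𝓡 d) (𝓡 d) ∞ F
  covers : ∀ y, p (F y) = f (p y)
  map_smul : ∀ (t : Torus k) (y : E), F (t • y) = torusAut A t • F y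

/-- The derivative at `0` of `ℝᵏ → E`, `v ↦ y.exp(v)`, which identifies `ℝᵏ` with the tangent space
of the fiber through `y`. -/
def orbitDeriv (k : ℕ) {d : ℕ} {E : Type v} [TopologicalSpace E]
    [ChartedSpace (EuclideanSpace ℝ (Fin d)) E] [MulAction (Torus k) E] (y : E) :
    EuclideanSpace ℝ (Fin k) →ₗ[ℝ] TangentSpace (𝓡 d) y :=
  (mfderiv 𝓘(ℝ, EuclideanSpace ℝ (Fin k)) (𝓡 d)
    (fun v : EuclideanSpace ℝ (Fin k) => torusExp k v • y) 0 :
      EuclideanSpace ℝ (Fin k) →L[ℝ] EuclideanSpace ℝ (Fin d)).toLinearMap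

/-- The `𝕋ᵏ`-invariant family of subspaces tangent to the fibers that is induced by a subspace
`V` of `ℝᵏ`. -/
def fiberwise (d : ℕ) {k : ℕ} {E : Type v} [TopologicalSpace E]
    [ChartedSpace (EuclideanSpace ℝ (Fin d)) E] [MulAction (Torus k) E]
    (V : Submodule ℝ (EuclideanSpace ℝ (Fin k))) (y : E) : Submodule ℝ (TangentSpace (𝓡 d) y) :=
  V.map (orbitDeriv k y)

/-- The vectors tangent to the fibers of `p`. -/
def vertical (b d : ℕ) {X : Type u} {E : Type v}
    [TopologicalSpace X] [ChartedSpace (EuclideanSpace ℝ (Fin b)) X]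
    [TopologicalSpace E] [ChartedSpace (EuclideanSpace ℝ (Fin d)) E]
    (p : E → X) (y : E) : Submodule ℝ (TangentSpace (𝓡 d) y) :=
  (mfderiv (𝓡 d) (𝓡 b) p y).ker

end Bundle

end TorusExt

end

/-!
Partial hyperbolicity of principal torus extensions.

The vertical behaviour of `F` is that of the linear map `A`, the horizontal behaviour is that of
`f`. What has to be found is a continuous invariant complement to the vertical stable and unstable
directions, and a metric on `E` in which the center directions grow at rates strictly between the
two.

*Diffeomorphism.* `F` is bijective because `f` and `A` are, and `DF` is injective because it covers
`Df` and acts on the fibers by `A`; the inverse is smooth by the inverse function theorem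
(`IsAMap.exists_diffeomorph`).

*Connection form.* Embedding the compact manifold `E` in a Euclidean space and dualizing the
fundamental vector fields of the torus action gives a smooth form `θ : TE → ℝᵏ` that restricts to
the identity on the fibers (`exists_dual_form`). It need not be invariant under the torus or under
`F`.

*Invariant forms.* For the projection `Ps` of `ℝᵏ` onto `E^s_A`, the twisted pullback
`η ↦ A ∘ (F⁻¹)^* η` changes `Ps ∘ θ` only by a form that vanishes on the fibers. Such forms are
bounded by the length of the projection of a vector to `X`, so on them, when their values are in
`E^s_A`, the pullback contracts by the factor `μ_s / m(f) < 1`, where `m(f)` is `Metric.derivMin`.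
A geometric series therefore corrects `Ps ∘ θ` to a continuous invariant form `θs`
(`VecForm.exists_fixed`, `exists_stable_form`). The unstable form `θu` arises in the same way from
`A⁻¹ ∘ F^* η` (`exists_unstable_form`). The center bundle is the kernel of `θs + θu`, and `H'` is the kernel of
`θs + Pc ∘ θ + θu`. The latter need not be invariant.

*Metric.* The metric `‖θ v‖² + K² ‖Dp v‖²` is the Euclidean one on the fibers. On the kernel of
`θs + θu` the form `θ` agrees with `Pc ∘ θ` up to `O(‖Dp v‖)`, and `Pc ∘ θ` is equivariant up to
an error of the same kind. For large `K` these errors are small compared to the length, so the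
center growth rates are as close as needed to those of `A` on `E^c_A` and of `f` on `X`
(`exists_metric_center`).

*Hyperbolicity.* A diffeomorphism of a closed manifold of positive dimension can be neither
uniformly contracting nor uniformly expanding (`not_contracting_of_surjective`), hence
`m(f) ≤ 1 ≤ max ‖Df‖` and `μ_s < 1 < λ_u`.
-/

noncomputable section

namespace TorusExt

open Bundle Set

/-! ### Frames of the tangent bundle and homogeneous functions on it -/

section

variable {n : ℕ} {M : Type*} [TopologicalSpace M] [ChartedSpace (EuclideanSpace ℝ (Fin n)) M]

/-- The linear parametrization of the tangent spaces near `x₀` given by the preferred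
trivialization of the tangent bundle at `x₀`. -/
def tangentFrame [IsManifold (𝓡 n) ∞ M] (x₀ x : M) :
    EuclideanSpace ℝ (Fin n) →L[ℝ] TangentSpace (𝓡 n) x :=
  (trivializationAt (EuclideanSpace ℝ (Fin n)) (TangentSpace (𝓡 n)) x₀).symmL ℝ x

/-- The open set on which `tangentFrame x₀` is an isomorphism. -/
def frameSet (n : ℕ) {M : Type*} [TopologicalSpace M]
    [ChartedSpace (EuclideanSpace ℝ (Fin n)) M] [IsManifold (𝓡 n) ∞ M] (x₀ : M) : Set M :=
  (trivializationAt (EuclideanSpace ℝ (Fin n)) (TangentSpace (𝓡 n) : M → Type _) x₀).baseSet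

lemma frameSet_mem_nhds [IsManifold (𝓡 n) ∞ M] (x₀ : M) : frameSet n x₀ ∈ 𝓝 x₀ :=
  (trivializationAt (EuclideanSpace ℝ (Fin n)) (TangentSpace (𝓡 n) : M → Type _)
    x₀).open_baseSet.mem_nhds (FiberBundle.mem_baseSet_trivializationAt' x₀)

lemma tangentFrame_apply [IsManifold (𝓡 n) ∞ M] {x₀ x : M} (hx : x ∈ frameSet n x₀)
    (v : EuclideanSpace ℝ (Fin n)) :
    tangentFrame x₀ x v = (trivializationAt (EuclideanSpace ℝ (Fin n))
      (TangentSpace (𝓡 n) : M → Type _) x₀).symm x v :=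
  Trivialization.symmL_apply _ hx v

lemma tangentFrame_bijective [IsManifold (𝓡 n) ∞ M] {x₀ x : M} (hx : x ∈ frameSet n x₀) :
    Function.Bijective (tangentFrame (n := n) x₀ x) :=
  ⟨Function.LeftInverse.injective fun y => Trivialization.continuousLinearMapAt_symmL _ hx y,
    Function.RightInverse.surjective fun y => Trivialization.symmL_continuousLinearMapAt _ hx y⟩

lemma contMDiffOn_tangentFrame [IsManifold (𝓡 n) ∞ M] (x₀ : M) (v : EuclideanSpace ℝ (Fin n)) :
    ContMDiffOn (𝓡 n) (𝓡 n).tangent ∞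
      (fun x => (⟨x, tangentFrame x₀ x v⟩ : TangentBundle (𝓡 n) M)) (frameSet n x₀) := by
  have h := (trivializationAt (EuclideanSpace ℝ (Fin n)) (TangentSpace (𝓡 n) : M → Type _)
    x₀).contMDiffOn_symm (IB := 𝓡 n) (n := ∞)
  have h2 : ContMDiffOn (𝓡 n) ((𝓡 n).prod 𝓘(ℝ, EuclideanSpace ℝ (Fin n))) ∞
    (fun x : M => (x, v)) (frameSet n x₀) := (contMDiff_id.prodMk contMDiff_const).contMDiffOn
  refine (h.comp h2 ?_).congr ?_
  · intro x hx
    exact ((trivializationAt (EuclideanSpace ℝ (Fin n)) (TangentSpace (𝓡 n) : M → Type _)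
    x₀).mem_target).2 hx
  · intro x hx
    rw [tangentFrame_apply hx]
    exact (trivializationAt (EuclideanSpace ℝ (Fin n)) (TangentSpace (𝓡 n) : M → Type _)
      x₀).mk_symm hx v

lemma continuousOn_tangentFrame [IsManifold (𝓡 n) ∞ M] (x₀ : M) :
    ContinuousOn (fun q : M × EuclideanSpace ℝ (Fin n) =>
      (⟨q.1, tangentFrame x₀ q.1 q.2⟩ : TangentBundle (𝓡 n) M)) (frameSet n x₀ ×ˢ univ) := by
  refine (trivializationAt (EuclideanSpace ℝ (Fin n)) (TangentSpace (𝓡 n) : M → Type _)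
    x₀).continuousOn_symm.congr fun q hq => ?_
  rw [tangentFrame_apply hq.1]

/-- On the tangent bundle of a compact manifold any two continuous fiberwise homogeneous functions,
one of which is positive off the zero section, are comparable. -/
lemma exists_forall_le_mul [IsManifold (𝓡 n) ∞ M] [CompactSpace M]
    {Q R : TangentBundle (𝓡 n) M → ℝ} (hQ : Continuous Q) (hR : Continuous R)
    (hQt : ∀ x (t : ℝ) (v : TangentSpace (𝓡 n) x), Q ⟨x, t • v⟩ = |t| * Q ⟨x, v⟩)
    (hRt : ∀ x (t : ℝ) (v : TangentSpace (𝓡 n) x), R ⟨x, t • v⟩ = |t| * R ⟨x, v⟩)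
    (hpos : ∀ x (v : TangentSpace (𝓡 n) x), v ≠ 0 → 0 < Q ⟨x, v⟩) :
    ∃ C : ℝ, 0 ≤ C ∧ ∀ x (v : TangentSpace (𝓡 n) x), R ⟨x, v⟩ ≤ C * Q ⟨x, v⟩ := by
  have hQ0 : ∀ x (v : TangentSpace (𝓡 n) x), 0 ≤ Q ⟨x, v⟩ := by
    intro x v
    by_cases hv : v = 0
    · have := hQt x 0 v
      rw [zero_smul, abs_zero, zero_mul] at this
      rw [hv, this]
    · exact (hpos x v hv).le
  have : LocallyCompactSpace M := Manifold.locallyCompact_of_finiteDimensional (𝓡 n)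
  -- locally, compare the functions on the product of a compact set with the unit sphere
  have key : ∀ x₀ : M, ∃ U ∈ 𝓝 x₀, ∃ C : ℝ, 0 ≤ C ∧
      ∀ x ∈ U, ∀ v : TangentSpace (𝓡 n) x, R ⟨x, v⟩ ≤ C * Q ⟨x, v⟩ := by
    intro x₀
    obtain ⟨K, hK, hKU, hKc⟩ := local_compact_nhds (frameSet_mem_nhds (n := n) x₀)
    set S := Metric.sphere (0 : EuclideanSpace ℝ (Fin n)) 1
    have hc : ContinuousOn (fun q : M × EuclideanSpace ℝ (Fin n) =>
      (⟨q.1, tangentFrame x₀ q.1 q.2⟩ : TangentBundle (𝓡 n) M)) (K ×ˢ S) :=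
      (continuousOn_tangentFrame x₀).mono (prod_mono hKU (subset_univ _))
    have hpos' : ∀ q ∈ K ×ˢ S, 0 < Q ⟨q.1, tangentFrame x₀ q.1 q.2⟩ := by
      rintro ⟨x, v⟩ ⟨hx, hv⟩
      refine hpos _ _ fun h => ?_
      have : v = 0 := (tangentFrame_bijective (hKU hx)).1 (by simpa using h)
      simp [S, this] at hv
    obtain ⟨C, hC⟩ := (hKc.prod (isCompact_sphere (0 : EuclideanSpace ℝ (Fin n))
      1)).bddAbove_image (f := fun q : M × EuclideanSpace ℝ (Fin n) =>
        R ⟨q.1, tangentFrame x₀ q.1 q.2⟩ / Q ⟨q.1, tangentFrame x₀ q.1 q.2⟩)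
      ((hR.comp_continuousOn hc).div (hQ.comp_continuousOn hc) fun q hq => (hpos' q hq).ne')
    refine ⟨K, hK, max C 0, le_max_right _ _, fun x hx v => ?_⟩
    obtain ⟨w, rfl⟩ := (tangentFrame_bijective (hKU hx)).2 v
    by_cases hw : w = 0
    · have h1 := hRt x 0 (tangentFrame x₀ x w)
      rw [zero_smul, abs_zero, zero_mul] at h1
      rw [hw, map_zero, h1]
      exact mul_nonneg (le_max_right _ _) (hQ0 _ _)
    · have hw' : ‖w‖ ≠ 0 := norm_ne_zero_iff.2 hw
      set u := ‖w‖⁻¹ • w with hu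
      have hwu : w = ‖w‖ • u := by rw [hu, smul_smul, mul_inv_cancel₀ hw', one_smul]
      have huS : u ∈ S := by simp [S, hu, norm_smul, hw']
      have h2 : R ⟨x, tangentFrame x₀ x u⟩ ≤ C * Q ⟨x, tangentFrame x₀ x u⟩ := by
        rw [← div_le_iff₀ (hpos' (x, u) ⟨hx, huS⟩)]
        exact hC ⟨(x, u), ⟨hx, huS⟩, rfl⟩
      rw [hwu, map_smul, hRt, hQt, mul_left_comm]
      refine mul_le_mul_of_nonneg_left (h2.trans ?_) (abs_nonneg _)
      exact mul_le_mul_of_nonneg_right (le_max_left _ _) (hQ0 _ _)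
  choose U hU C hC0 hC using key
  obtain ⟨t, ht⟩ := CompactSpace.elim_nhds_subcover U hU
  refine ⟨∑ x ∈ t, C x, Finset.sum_nonneg fun x _ => hC0 x, fun x v => ?_⟩
  obtain ⟨y, hy, hxy⟩ : ∃ y ∈ t, x ∈ U y := by
    have : x ∈ ⋃ y ∈ t, U y := ht ▸ mem_univ x
    simpa using this
  refine (hC y x hxy v).trans (mul_le_mul_of_nonneg_right ?_ (hQ0 _ _))
  exact Finset.single_le_sum (f := C) (fun x _ => hC0 x) hy

/-- A continuous field of projections of the tangent spaces, of constant rank, has a subbundle as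
its range. -/
lemma isSubbundle_range_of_projection [IsManifold (𝓡 n) ∞ M] {r : ℕ}
    {V : ∀ x : M, Submodule ℝ (TangentSpace (𝓡 n) x)}
    (P : ∀ x : M, TangentSpace (𝓡 n) x →ₗ[ℝ] TangentSpace (𝓡 n) x)
    (hP : ∀ z : M, ∀ v : EuclideanSpace ℝ (Fin n), ContinuousOn
      (fun x => (⟨x, P x (tangentFrame z x v)⟩ : TangentBundle (𝓡 n) M)) (frameSet n z))
    (hV : ∀ x v, P x v ∈ V x) (hid : ∀ x, ∀ v ∈ V x, P x v = v)
    (hr : ∀ x, Module.finrank ℝ (V x) = r) : IsSubbundle V := by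
  intro x₀
  have hfd : ∀ x : M, FiniteDimensional ℝ (TangentSpace (𝓡 n) x) := fun x =>
    inferInstanceAs (FiniteDimensional ℝ (EuclideanSpace ℝ (Fin n)))
  let b := Module.finBasisOfFinrankEq ℝ (V x₀) (hr x₀)
  choose w hw using fun i : Fin r =>
    (tangentFrame_bijective (mem_of_mem_nhds (frameSet_mem_nhds (n := n) x₀))).2
      (b i : TangentSpace (𝓡 n) x₀)
  -- extend a basis of `V x₀` to constant vectors in the frame and project them to `V x`
  let s : Fin r → ∀ x : M, TangentSpace (𝓡 n) x := fun i x => P x (tangentFrame x₀ x (w i))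
  have hs : ∀ i, ContinuousOn (fun x => (⟨x, s i x⟩ : TangentBundle (𝓡 n) M)) (frameSet n x₀) :=
    fun i => hP x₀ (w i)
  let e := trivializationAt (EuclideanSpace ℝ (Fin n)) (TangentSpace (𝓡 n) : M → Type _) x₀
  let c : M → Fin r → EuclideanSpace ℝ (Fin n) := fun x i => (e ⟨x, s i x⟩).2
  have hc : ContinuousAt c x₀ := by
    refine continuousAt_pi.2 fun i => ?_
    have h1 := (hs i).continuousAt (frameSet_mem_nhds (n := n) x₀)
    have h2 : ContinuousAt e ⟨x₀, s i x₀⟩ := e.continuousAt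
      (e.mem_source.2 (FiberBundle.mem_baseSet_trivializationAt' x₀))
    exact continuous_snd.continuousAt.comp (h2.comp (f := fun x => (⟨x, s i x⟩ :
      TangentBundle (𝓡 n) M)) h1)
  have hcl : ∀ x ∈ frameSet n x₀, (fun i => s i x) = tangentFrame x₀ x ∘ c x := fun x hx => by
    funext i
    exact ((tangentFrame_apply hx _).trans (e.symm_apply_apply_mk hx (s i x))).symm
  have hli0 : LinearIndependent ℝ (c x₀) := by
    have h1 : LinearIndependent ℝ (fun i => s i x₀) := by
      have : (fun i => s i x₀) = fun i => ((b i : V x₀) : TangentSpace (𝓡 n) x₀) := by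
        funext i
        simp only [s, hw]
        exact hid _ _ (b i).2
      rw [this]
      exact b.linearIndependent.map' (V x₀).subtype (Submodule.ker_subtype _)
    rw [hcl x₀ (mem_of_mem_nhds (frameSet_mem_nhds (n := n) x₀))] at h1
    exact LinearIndependent.of_comp (tangentFrame x₀ x₀).toLinearMap h1
  -- linear independence is an open condition on the coordinate vectors `c x`
  have hopen := hc.preimage_mem_nhds (hli0.eventually)
  refine ⟨frameSet n x₀ ∩ c ⁻¹' {f | LinearIndependent ℝ f},
    Filter.inter_mem (frameSet_mem_nhds (n := n) x₀) hopen, r, s,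
    fun i => (hs i).mono inter_subset_left, ?_⟩
  rintro x ⟨hx, hxl⟩
  have hli : LinearIndependent ℝ (fun i => s i x) := by
    rw [hcl x hx]
    exact LinearIndependent.map' (v := c x) hxl (tangentFrame x₀ x).toLinearMap
      (LinearMap.ker_eq_bot.2 (tangentFrame_bijective hx).1)
  refine ⟨hli, ?_⟩
  apply Submodule.eq_of_le_of_finrank_eq
  · rw [Submodule.span_le]
    rintro _ ⟨i, rfl⟩
    exact hV _ _
  · rw [finrank_span_eq_card hli, hr, Fintype.card_fin]

end

/-! ### Riemannian metrics and the inverse function theorem -/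

section

variable {n : ℕ} {M : Type*} [TopologicalSpace M] [ChartedSpace (EuclideanSpace ℝ (Fin n)) M]

section Metric

lemma Metric.len_sq [IsManifold (𝓡 n) ∞ M] (g : Metric n M) {x : M} (v : TangentSpace (𝓡 n) x) :
    g.len v ^ 2 = g.inner x v v := by
  refine Real.sq_sqrt ?_
  by_cases hv : v = 0
  · simp [hv]
  · exact (g.pos x v hv).le

lemma Metric.len_nonneg [IsManifold (𝓡 n) ∞ M] (g : Metric n M) {x : M}
    (v : TangentSpace (𝓡 n) x) : 0 ≤ g.len v := Real.sqrt_nonneg _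

lemma Metric.len_pos [IsManifold (𝓡 n) ∞ M] (g : Metric n M) {x : M}
    {v : TangentSpace (𝓡 n) x} (hv : v ≠ 0) : 0 < g.len v := Real.sqrt_pos.2 (g.pos x v hv)

lemma Metric.len_smul [IsManifold (𝓡 n) ∞ M] (g : Metric n M) {x : M} (t : ℝ)
    (v : TangentSpace (𝓡 n) x) : g.len (t • v) = |t| * g.len v := by
  unfold Metric.len
  rw [← Real.sqrt_sq_eq_abs, ← Real.sqrt_mul (sq_nonneg t)]
  congr 1
  simp only [map_smul, smul_apply, smul_eq_mul]
  ring

lemma Metric.continuous_len [IsManifold (𝓡 n) ∞ M] (g : Metric n M) :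
    Continuous (fun z : TangentBundle (𝓡 n) M => g.len z.2) := by
  refine Real.continuous_sqrt.comp ?_
  let := (⟨g.toRiemannianMetric⟩ : RiemannianBundle (TangentSpace (𝓡 n) : M → Type _))
  have h : ContMDiff (𝓡 n).tangent 𝓘(ℝ, ℝ) ∞ (fun z : TangentBundle (𝓡 n) M =>
      inner ℝ z.2 z.2) :=
    ContMDiff.inner_bundle (IB := 𝓡 n) (b := fun z : TangentBundle (𝓡 n) M => z.1)
      contMDiff_id contMDiff_id
  exact h.continuous

lemma Metric.contMDiffAt_inner [IsManifold (𝓡 n) ∞ M] (g : Metric n M)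
    {HN EN : Type*} [NormedAddCommGroup EN] [NormedSpace ℝ EN] [TopologicalSpace HN]
    {J : ModelWithCorners ℝ EN HN} {N : Type*} [TopologicalSpace N] [ChartedSpace HN N]
    {b : N → M} {v w : ∀ y, TangentSpace (𝓡 n) (b y)} {x : N}
    (hv : ContMDiffAt J (𝓡 n).tangent ∞ (fun y => (⟨b y, v y⟩ : TangentBundle (𝓡 n) M)) x)
    (hw : ContMDiffAt J (𝓡 n).tangent ∞ (fun y => (⟨b y, w y⟩ : TangentBundle (𝓡 n) M)) x) :
    ContMDiffAt J 𝓘(ℝ, ℝ) ∞ (fun y => g.inner (b y) (v y) (w y)) x := by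
  let := (⟨g.toRiemannianMetric⟩ : RiemannianBundle (TangentSpace (𝓡 n) : M → Type _))
  exact ContMDiffAt.inner_bundle (IB := 𝓡 n) hv hw

/-- A field of positive definite symmetric forms that is smooth on the local frames
`tangentFrame` is a Riemannian metric. -/
lemma exists_metric_of_bilin [IsManifold (𝓡 n) ∞ M]
    (B : ∀ x : M, TangentSpace (𝓡 n) x →ₗ[ℝ] TangentSpace (𝓡 n) x →ₗ[ℝ] ℝ)
    (hsymm : ∀ x v w, B x v w = B x w v) (hpos : ∀ x v, v ≠ 0 → 0 < B x v v)
    (hB : ∀ (x₀ : M) (v w : EuclideanSpace ℝ (Fin n)), ContMDiffOn (𝓡 n) 𝓘(ℝ, ℝ) ∞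
      (fun x => B x (tangentFrame x₀ x v) (tangentFrame x₀ x w)) (frameSet n x₀)) :
    ∃ g : Metric n M, ∀ x v w, g.inner x v w = B x v w := by
  have hfd : ∀ x : M, FiniteDimensional ℝ (TangentSpace (𝓡 n) x) := fun x =>
    inferInstanceAs (FiniteDimensional ℝ (EuclideanSpace ℝ (Fin n)))
  have hT2 : ∀ x : M, T2Space (TangentSpace (𝓡 n) x) := fun x =>
    inferInstanceAs (T2Space (EuclideanSpace ℝ (Fin n)))
  refine ⟨⟨fun x => (B x).toContinuousBilinearMap, fun x v w => hsymm x v w,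
    fun x v hv => hpos x v hv, ?_, ?_⟩, fun x v w => rfl⟩
  · intro x
    -- the unit ball of `B x` is bounded, since `B x` has a positive minimum on the unit sphere
    change Bornology.IsVonNBounded ℝ {v : EuclideanSpace ℝ (Fin n) | B x v v < 1}
    rw [NormedSpace.isVonNBounded_iff]
    have hc : Continuous fun v : EuclideanSpace ℝ (Fin n) => B x v v := by
      let B' : EuclideanSpace ℝ (Fin n) →L[ℝ] EuclideanSpace ℝ (Fin n) →L[ℝ] ℝ :=
        LinearMap.toContinuousBilinearMap (B x)
      exact (B'.continuous.clm_apply continuous_id)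
    by_cases hne : (Metric.sphere (0 : EuclideanSpace ℝ (Fin n)) 1).Nonempty
    · obtain ⟨u, hu, hmin⟩ := (isCompact_sphere (0 : EuclideanSpace ℝ (Fin n)) 1).exists_isMinOn
        hne hc.continuousOn
      have hu0 : (u : EuclideanSpace ℝ (Fin n)) ≠ 0 := by
        rintro rfl
        simp at hu
      have hcpos : 0 < B x u u := hpos x u hu0
      refine (Metric.isBounded_closedBall (x := (0 : EuclideanSpace ℝ (Fin n)))
        (r := √(1 / B x u u))).subset fun v hv => ?_
      rw [mem_closedBall_zero_iff]
      refine Real.le_sqrt_of_sq_le ?_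
      rw [le_div_iff₀ hcpos]
      by_cases hv0 : v = 0
      · simp [hv0]
      have hn : ‖v‖ ≠ 0 := norm_ne_zero_iff.2 hv0
      have hs : (‖v‖⁻¹ • v : EuclideanSpace ℝ (Fin n)) ∈ Metric.sphere 0 1 := by
        simp [norm_smul, hn]
      have h1 : B x u u ≤ B x (‖v‖⁻¹ • v : EuclideanSpace ℝ (Fin n))
        (‖v‖⁻¹ • v : EuclideanSpace ℝ (Fin n)) := hmin hs
      have h2 : B x (‖v‖⁻¹ • v : EuclideanSpace ℝ (Fin n))
          (‖v‖⁻¹ • v : EuclideanSpace ℝ (Fin n)) = ‖v‖⁻¹ * (‖v‖⁻¹ * B x v v) := by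
        have h3 := (B x).map_smul ‖v‖⁻¹ v
        have h4 := (B x v).map_smul ‖v‖⁻¹ v
        have h5 := congrArg (fun l : TangentSpace (𝓡 n) x →ₗ[ℝ] ℝ =>
          l (‖v‖⁻¹ • v : EuclideanSpace ℝ (Fin n))) h3
        exact h5.trans (congrArg (fun t => ‖v‖⁻¹ * t) h4)
      rw [h2] at h1
      have h6 : B x v v < 1 := hv
      calc ‖v‖ ^ 2 * B x u u ≤ ‖v‖ ^ 2 * (‖v‖⁻¹ * (‖v‖⁻¹ * B x v v)) := by gcongr
        _ = B x v v := by field_simp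
        _ ≤ 1 := h6.le
    · refine (Metric.isBounded_closedBall (x := (0 : EuclideanSpace ℝ (Fin n)))
        (r := 0)).subset fun v hv => ?_
      rw [mem_closedBall_zero_iff]
      by_contra h
      push Not at h
      exact hne ⟨‖v‖⁻¹ • v, by simp [norm_smul, h.ne']⟩
  · intro x₀
    rw [contMDiffAt_hom_bundle]
    refine ⟨contMDiffAt_id, ?_⟩
    -- in the coordinates of the frame at `x₀` the form is its Gram matrix
    let Φ : Fin n → Fin n → (EuclideanSpace ℝ (Fin n) →L[ℝ] EuclideanSpace ℝ (Fin n) →L[ℝ] ℝ) :=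
      fun i j => (EuclideanSpace.proj i : EuclideanSpace ℝ (Fin n) →L[ℝ] ℝ).smulRight
        (EuclideanSpace.proj j : EuclideanSpace ℝ (Fin n) →L[ℝ] ℝ)
    have hsm : ContMDiffAt (𝓡 n)
        𝓘(ℝ, EuclideanSpace ℝ (Fin n) →L[ℝ] EuclideanSpace ℝ (Fin n) →L[ℝ] ℝ) ∞
        (fun x => ∑ i, ∑ j, (B x (tangentFrame x₀ x (EuclideanSpace.single i 1))
          (tangentFrame x₀ x (EuclideanSpace.single j 1))) • Φ i j) x₀ := by
      refine contMDiffAt_finsetSum fun i _ => contMDiffAt_finsetSum fun j _ => ?_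
      exact ((hB x₀ _ _).contMDiffAt (frameSet_mem_nhds x₀)).smul contMDiffAt_const
    refine hsm.congr_of_eventuallyEq ?_
    filter_upwards [frameSet_mem_nhds (n := n) x₀] with x hx
    ext v w
    have h := inCoordinates_apply_eq₂ (𝕜 := ℝ) (x₀ := x₀) (x := x)
      (F₁ := EuclideanSpace ℝ (Fin n)) (F₂ := EuclideanSpace ℝ (Fin n)) (F₃ := ℝ)
      (E₁ := fun x : M => TangentSpace (𝓡 n) x) (E₂ := fun x : M => TangentSpace (𝓡 n) x)
      (E₃ := Bundle.Trivial M ℝ)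
      (ϕ := (B x).toContinuousBilinearMap) (v := v) (w := w) hx hx (mem_univ _)
    refine Eq.trans h ?_
    rw [← tangentFrame_apply hx, ← tangentFrame_apply hx]
    have hv : v = ∑ i, v i • (EuclideanSpace.single i (1 : ℝ) : EuclideanSpace ℝ (Fin n)) := by
      ext j
      simp [Finset.sum_apply, Pi.single_apply]
    have hw : w = ∑ i, w i • (EuclideanSpace.single i (1 : ℝ) : EuclideanSpace ℝ (Fin n)) := by
      ext j
      simp [Finset.sum_apply, Pi.single_apply]
    trans B x (tangentFrame x₀ x v) (tangentFrame x₀ x w)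
    · simp [LinearMap.toContinuousBilinearMap_apply]
    · conv_lhs => rw [hv, hw]
      simp only [map_sum, map_smul, LinearMap.sum_apply, LinearMap.smul_apply, Φ,
        _root_.sum_apply, _root_.smul_apply,
        ContinuousLinearMap.smulRight_apply, PiLp.proj_apply, smul_eq_mul]
      rw [Finset.sum_comm]
      refine Finset.sum_congr rfl fun i _ => ?_
      rw [Finset.mul_sum]
      refine Finset.sum_congr rfl fun j _ => ?_
      ring

end Metric

section Diffeo

/-- A smooth bijection with injective derivatives is a diffeomorphism. -/
lemma exists_diffeomorph_of_bijective [IsManifold (𝓡 n) ∞ M] {F : M → M}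
    (hF : ContMDiff (𝓡 n) (𝓡 n) ∞ F) (hb : Function.Bijective F)
    (hinj : ∀ x, Function.Injective (mfderiv (𝓡 n) (𝓡 n) F x)) :
    ∃ Φ : M ≃ₘ^∞⟮𝓡 n, 𝓡 n⟯ M, ∀ x, Φ x = F x := by
  let e := Equiv.ofBijective F hb
  refine ⟨⟨e, hF, fun y₀ => ?_⟩, fun x => rfl⟩
  obtain ⟨x₀, rfl⟩ := hb.2 y₀
  set φ := extChartAt (𝓡 n) x₀
  set ψ := extChartAt (𝓡 n) (F x₀)
  set h : EuclideanSpace ℝ (Fin n) → EuclideanSpace ℝ (Fin n) :=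
    writtenInExtChartAt (𝓡 n) (𝓡 n) x₀ F with hdef
  have hsm : ContDiffAt ℝ ∞ h (φ x₀) := by
    have := (contMDiffAt_iff.1 (hF x₀)).2
    rw [modelWithCornersSelf_coe, range_id, contDiffWithinAt_univ] at this
    exact this
  have hder : HasFDerivAt h (mfderiv (𝓡 n) (𝓡 n) F x₀ :
      EuclideanSpace ℝ (Fin n) →L[ℝ] EuclideanSpace ℝ (Fin n)) (φ x₀) := by
    have := ((hF x₀).mdifferentiableAt (by simp)).hasMFDerivAt.2
    rw [modelWithCornersSelf_coe, range_id] at this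
    exact hasFDerivWithinAt_univ.1 this
  let D : EuclideanSpace ℝ (Fin n) →L[ℝ] EuclideanSpace ℝ (Fin n) := mfderiv (𝓡 n) (𝓡 n) F x₀
  let L : EuclideanSpace ℝ (Fin n) ≃L[ℝ] EuclideanSpace ℝ (Fin n) :=
    (LinearEquiv.ofInjectiveEndo D.toLinearMap (hinj x₀)).toContinuousLinearEquiv
  have hL : HasFDerivAt h (L : EuclideanSpace ℝ (Fin n) →L[ℝ] EuclideanSpace ℝ (Fin n))
      (φ x₀) := by
    have : (L : EuclideanSpace ℝ (Fin n) →L[ℝ] EuclideanSpace ℝ (Fin n)) = D := by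
      ext v
      rfl
    rw [this]
    exact hder
  have hhx : h (φ x₀) = ψ (F x₀) := by simp [h, φ, ψ, writtenInExtChartAt]
  -- `H` is the local inverse given by the inverse function theorem in the charts at `x₀`, `F x₀`
  let H := hsm.toOpenPartialHomeomorph h hL (by simp)
  have hH : (H : EuclideanSpace ℝ (Fin n) → EuclideanSpace ℝ (Fin n)) = h :=
    hsm.toOpenPartialHomeomorph_coe hL (by simp)
  have hs : φ x₀ ∈ H.source := hsm.mem_toOpenPartialHomeomorph_source hL (by simp)
  have ht : ψ (F x₀) ∈ H.target :=
    hhx ▸ hsm.image_mem_toOpenPartialHomeomorph_target hL (by simp)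
  have hsymm : ContDiffAt ℝ ∞ H.symm (ψ (F x₀)) := by
    have := hsm.to_localInverse hL (by simp)
    rw [hhx] at this
    exact this
  have hHx : H.symm (ψ (F x₀)) = φ x₀ := by
    rw [← hhx, ← hH]
    exact H.left_inv hs
  have hφsymm : ContMDiffAt (𝓡 n) (𝓡 n) ∞ φ.symm (φ x₀) :=
    (contMDiffOn_extChartAt_symm x₀).contMDiffAt (extChartAt_target_mem_nhds x₀)
  have hG : ContMDiffAt (𝓡 n) (𝓡 n) ∞ (fun z => φ.symm (H.symm (ψ z))) (F x₀) := by
    have h1 : ContMDiffAt (𝓡 n) (𝓡 n) ∞ ψ (F x₀) := contMDiffAt_extChartAt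
    have h2 : ContMDiffAt (𝓡 n) (𝓡 n) ∞ H.symm (ψ (F x₀)) := hsymm.contMDiffAt
    have h3 : ContMDiffAt (𝓡 n) (𝓡 n) ∞ (fun z => H.symm (ψ z)) (F x₀) :=
      ContMDiffAt.comp (F x₀) h2 h1
    exact ContMDiffAt.comp (F x₀) (g := φ.symm) (by rw [hHx]; exact hφsymm) h3
  refine hG.congr_of_eventuallyEq ?_
  have hGx : φ.symm (H.symm (ψ (F x₀))) = x₀ := by
    rw [hHx]
    exact extChartAt_to_inv x₀
  have hFG : ContinuousAt (fun z => F (φ.symm (H.symm (ψ z)))) (F x₀) :=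
    ContinuousAt.comp (g := F) hF.continuous.continuousAt hG.continuousAt
  have e1 : ∀ᶠ z in 𝓝 (F x₀), F (φ.symm (H.symm (ψ z))) ∈ ψ.source :=
    hFG.preimage_mem_nhds (by rw [hGx]; exact extChartAt_source_mem_nhds _)
  have e2 : ∀ᶠ z in 𝓝 (F x₀), ψ z ∈ H.target :=
    (continuousAt_extChartAt (F x₀)).preimage_mem_nhds (H.open_target.mem_nhds ht)
  filter_upwards [e1, e2, extChartAt_source_mem_nhds (I := 𝓡 n) (F x₀)] with z hz1 hz2 hz3
  rw [show e.symm z = φ.symm (H.symm (ψ z)) ↔ z = F (φ.symm (H.symm (ψ z))) from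
    e.symm_apply_eq]
  refine ψ.injOn hz3 hz1 ?_
  have := H.right_inv hz2
  rw [hH] at this
  exact this.symm

end Diffeo

end

/-! ### Closed manifolds are not uniformly contracted -/

section

variable {n : ℕ} {M : Type*} [TopologicalSpace M] [ChartedSpace (EuclideanSpace ℝ (Fin n)) M]

/-- The derivative of a vector-valued function on a manifold, with values in the vector space
itself instead of its tangent spaces. -/
def vderiv {N : ℕ} (h : M → EuclideanSpace ℝ (Fin N)) (x : M) :
    TangentSpace (𝓡 n) x →L[ℝ] EuclideanSpace ℝ (Fin N) :=
  mfderiv (𝓡 n) (𝓡 N) h x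

lemma contMDiff_vderiv [IsManifold (𝓡 n) ∞ M] {N : ℕ} {h : M → EuclideanSpace ℝ (Fin N)}
    (hh : ContMDiff (𝓡 n) (𝓡 N) ∞ h) :
    ContMDiff (𝓡 n).tangent (𝓡 N) ∞
      (fun z : TangentBundle (𝓡 n) M => vderiv h z.1 z.2) :=
  contMDiff_snd_tangentBundle_modelSpace (EuclideanSpace ℝ (Fin N)) (𝓡 N) |>.comp
    (hh.contMDiff_tangentMap (m := ∞) (by rfl))

lemma vderiv_comp {m N : ℕ} {M' : Type*} [TopologicalSpace M']
    [ChartedSpace (EuclideanSpace ℝ (Fin m)) M'] {h : M' → EuclideanSpace ℝ (Fin N)} {f : M → M'}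
    {x : M} (hh : MDifferentiableAt (𝓡 m) (𝓡 N) h (f x))
    (hf : MDifferentiableAt (𝓡 n) (𝓡 m) f x) (v : TangentSpace (𝓡 n) x) :
    vderiv (h ∘ f) x v = vderiv h (f x) (mfderiv (𝓡 n) (𝓡 m) f x v) :=
  congrFun (congrArg DFunLike.coe (mfderiv_comp x hh hf)) v

/-- Near any point, the oscillation of smooth maps `M → ℝᴺ` is controlled by a bound `B` on their
derivatives with respect to a Riemannian metric. The neighbourhood and the constant do not depend on
the map. -/
lemma exists_nhds_forall_norm_sub_le [IsManifold (𝓡 n) ∞ M] [T2Space M]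
    (g : Metric n M) {N : ℕ} (x₀ : M) :
    ∃ U ∈ 𝓝 x₀, ∃ C : ℝ, 0 ≤ C ∧ ∀ (h : M → EuclideanSpace ℝ (Fin N)) (B : ℝ),
      ContMDiff (𝓡 n) (𝓡 N) ∞ h → 0 ≤ B →
      (∀ x (v : TangentSpace (𝓡 n) x),
        ‖vderiv h x v‖ ≤ B * g.len v) →
      ∀ x ∈ U, ∀ y ∈ U, ‖h x - h y‖ ≤ C * B := by
  have : LocallyCompactSpace M := Manifold.locallyCompact_of_finiteDimensional (𝓡 n)
  obtain ⟨K, hK, hKU, hKc⟩ := local_compact_nhds (frameSet_mem_nhds (n := n) x₀)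
  obtain ⟨C, hC⟩ := (hKc.prod (isCompact_closedBall (0 : EuclideanSpace ℝ (Fin n))
    1)).bddAbove_image (f := fun q : M × EuclideanSpace ℝ (Fin n) =>
      g.len (tangentFrame x₀ q.1 q.2))
    (g.continuous_len.comp_continuousOn
      ((continuousOn_tangentFrame x₀).mono (prod_mono hKU (subset_univ _))))
  have hC' : ∀ x ∈ K, ∀ v : EuclideanSpace ℝ (Fin n),
      g.len (tangentFrame x₀ x v) ≤ max C 0 * ‖v‖ := by
    intro x hx v
    by_cases hv : v = 0
    · simp [hv, Metric.len]
    have hn : ‖v‖ ≠ 0 := norm_ne_zero_iff.2 hv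
    have h1 : g.len (tangentFrame x₀ x (‖v‖⁻¹ • v)) ≤ C :=
      hC ⟨(x, ‖v‖⁻¹ • v), ⟨hx, by simp [norm_smul, hn]⟩, rfl⟩
    rw [map_smul, g.len_smul, abs_of_nonneg (by positivity), inv_mul_le_iff₀ (by positivity)] at h1
    calc _ ≤ ‖v‖ * C := h1
      _ ≤ ‖v‖ * max C 0 := by gcongr; exact le_max_left _ _
      _ = _ := mul_comm _ _
  set φ := extChartAt (𝓡 n) x₀ with hφ
  have hnh : φ.target ∩ φ.symm ⁻¹' K ∈ 𝓝 (φ x₀) :=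
    Filter.inter_mem (extChartAt_target_mem_nhds x₀)
      ((continuousAt_extChartAt_symm x₀).preimage_mem_nhds
        (by rw [extChartAt_to_inv x₀]; exact hK))
  obtain ⟨r, hr, hball⟩ := Metric.mem_nhds_iff.1 hnh
  refine ⟨φ.source ∩ φ ⁻¹' Metric.ball (φ x₀) r,
    Filter.inter_mem (extChartAt_source_mem_nhds x₀)
      ((continuousAt_extChartAt x₀).preimage_mem_nhds (Metric.ball_mem_nhds _ hr)),
    max C 0 * (2 * r), by positivity, fun h B hh hB hhB x hx y hy => ?_⟩
  have hder : ∀ w ∈ Metric.ball (φ x₀) r, HasFDerivWithinAt (h ∘ φ.symm)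
      ((vderiv (n := n) h (φ.symm w)).comp (tangentFrame x₀ (φ.symm w)))
      (Metric.ball (φ x₀) r) w := by
    intro w hw
    have hwt := (hball hw).1
    have hsrc : φ.symm w ∈ (chartAt (EuclideanSpace ℝ (Fin n)) x₀).source := by
      rw [← extChartAt_source (𝓡 n)]
      exact φ.map_target hwt
    have h1 : tangentFrame x₀ (φ.symm w) =
        mfderivWithin 𝓘(ℝ, EuclideanSpace ℝ (Fin n)) (𝓡 n) φ.symm (range (𝓡 n)) w := by
      have := TangentBundle.symmL_trivializationAt (I := 𝓡 n) hsrc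
      rw [← hφ, φ.right_inv hwt] at this
      exact this
    have h2 : MDifferentiableWithinAt 𝓘(ℝ, EuclideanSpace ℝ (Fin n)) (𝓡 n) φ.symm
        (range (𝓡 n)) w := mdifferentiableWithinAt_extChartAt_symm hwt
    have h3 := (hh.mdifferentiableAt (x := φ.symm w) (by simp)).hasMFDerivAt.comp_hasMFDerivWithinAt
      w h2.hasMFDerivWithinAt
    rw [modelWithCornersSelf_coe, range_id] at h1 h3
    rw [h1]
    exact (hasMFDerivWithinAt_iff_hasFDerivWithinAt.1 h3).mono (subset_univ _)
  have hbound : ∀ w ∈ Metric.ball (φ x₀) r,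
      ‖(vderiv (n := n) h (φ.symm w)).comp (tangentFrame x₀ (φ.symm w))‖ ≤ max C 0 * B := by
    intro w hw
    refine ContinuousLinearMap.opNorm_le_bound _ (by positivity) fun v => ?_
    calc _ ≤ B * g.len (tangentFrame x₀ (φ.symm w) v) := hhB _ _
      _ ≤ B * (max C 0 * ‖v‖) := by gcongr; exact hC' _ (hball hw).2 v
      _ = _ := by ring
  have hmv := (convex_ball (φ x₀) r).norm_image_sub_le_of_norm_hasFDerivWithin_le hder hbound
    hy.2 hx.2
  simp only [Function.comp, φ.left_inv hx.1, φ.left_inv hy.1] at hmv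
  refine hmv.trans ?_
  have : ‖φ x - φ y‖ ≤ 2 * r := by
    have h1 := mem_ball_iff_norm.1 hx.2
    have h2 := mem_ball_iff_norm.1 hy.2
    calc ‖φ x - φ y‖ = ‖(φ x - φ x₀) - (φ y - φ x₀)‖ := by congr 1; abel
      _ ≤ _ := norm_sub_le _ _
      _ ≤ 2 * r := by linarith
  calc max C 0 * B * ‖φ x - φ y‖ ≤ max C 0 * B * (2 * r) := by gcongr
    _ = _ := by ring

/-- A nonempty manifold of positive dimension has infinitely many points. -/
lemma infinite_of_chartedSpace [NeZero n] [Nonempty M] : Infinite M := by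
  obtain ⟨x₀⟩ := ‹Nonempty M›
  have h : (extChartAt (𝓡 n) x₀).target.Infinite :=
    infinite_of_mem_nhds _ (extChartAt_target_mem_nhds x₀)
  rw [← (extChartAt (𝓡 n) x₀).image_source_eq_target] at h
  exact infinite_univ_iff.1 ((h.of_image _).mono (subset_univ _))

/-- A closed manifold of positive dimension has no uniformly contracting smooth surjection `f`.
Indeed, a fixed finite cover would have images under the iterates of `f` of diameters tending to
zero, which cannot cover more points than there are sets in the cover. -/
lemma not_contracting_of_surjective [IsManifold (𝓡 n) ∞ M] [T2Space M] [CompactSpace M]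
    [NeZero n] [Nonempty M] (g : Metric n M) {f : M → M} (hf : ContMDiff (𝓡 n) (𝓡 n) ∞ f)
    (hs : Function.Surjective f) {D : ℝ} (hD0 : 0 ≤ D) (hD : D < 1) :
    ¬ ∀ x (v : TangentSpace (𝓡 n) x), g.len (mfderiv (𝓡 n) (𝓡 n) f x v) ≤ D * g.len v := by
  intro hfD
  obtain ⟨N, ι, hι, hιe, -⟩ := exists_embedding_euclidean_of_compact (I := 𝓡 n) (M := M)
  obtain ⟨C, hC0, hC⟩ := exists_forall_le_mul (n := n) (M := M)
    (Q := fun z => g.len z.2)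
    (R := fun z => ‖vderiv ι z.1 z.2‖)
    g.continuous_len (contMDiff_vderiv hι).continuous.norm (fun x t v => g.len_smul t v)
    (fun x t v => by
      rw [map_smul, norm_smul, Real.norm_eq_abs]) (fun x v hv => g.len_pos hv)
  have hiter : ∀ j : ℕ, ContMDiff (𝓡 n) (𝓡 n) ∞ f^[j] := fun j => by
    induction j with
    | zero => exact contMDiff_id
    | succ j ih => exact ih.comp hf
  have hiterD : ∀ (j : ℕ) x (v : TangentSpace (𝓡 n) x),
      ‖vderiv (ι ∘ f^[j]) x v‖ ≤ C * D ^ j * g.len v := by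
    intro j
    induction j with
    | zero => intro x v; simpa using hC x v
    | succ j ih =>
      intro x v
      rw [Function.iterate_succ, ← Function.comp_assoc,
        vderiv_comp ((hι.comp (hiter j)).mdifferentiableAt (by simp))
          (hf.mdifferentiableAt (by simp))]
      calc _ ≤ C * D ^ j * g.len (mfderiv (𝓡 n) (𝓡 n) f x v) := ih _ _
        _ ≤ C * D ^ j * (D * g.len v) := by gcongr; exact hfD x v
        _ = _ := by ring
  choose U hU c hc0 hc using fun x₀ : M => exists_nhds_forall_norm_sub_le g (N := N) x₀
  obtain ⟨t, ht⟩ := CompactSpace.elim_nhds_subcover U hU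
  have := infinite_of_chartedSpace (n := n) (M := M)
  obtain ⟨S, hS⟩ := Infinite.exists_subset_card_eq M (t.card + 1)
  set c' := ∑ x ∈ t, c x
  -- two of the points of `S` have preimages under `f^[j]` in the same set of the cover
  have hpair : ∀ j : ℕ, ∃ a ∈ S, ∃ b ∈ S, a ≠ b ∧ ‖ι a - ι b‖ ≤ c' * (C * D ^ j) := by
    intro j
    choose q hq using hs.iterate j
    choose i hi using fun x : M => (by simpa using (ht ▸ mem_univ x : x ∈ ⋃ y ∈ t, U y) :
      ∃ y ∈ t, x ∈ U y)
    obtain ⟨a, ha, b, hb, hab, hiab⟩ := Finset.exists_ne_map_eq_of_card_lt_of_maps_to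
      (s := S) (t := t) (f := fun a => i (q a)) (by omega) (fun a _ => (hi (q a)).1)
    refine ⟨a, ha, b, hb, hab, ?_⟩
    have h1 := hc (i (q a)) (ι ∘ f^[j]) (C * D ^ j) (hι.comp (hiter j)) (by positivity)
      (hiterD j) (q a) (hi (q a)).2 (q b) (by rw [hiab]; exact (hi (q b)).2)
    simp only [Function.comp, hq] at h1
    refine h1.trans (mul_le_mul_of_nonneg_right ?_ (by positivity))
    exact Finset.single_le_sum (f := c) (fun x _ => hc0 x) (hi (q a)).1
  have hne : (S.offDiag).Nonempty := by
    obtain ⟨a, ha, b, hb, hab, -⟩ := hpair 0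
    exact ⟨(a, b), Finset.mem_offDiag.2 ⟨ha, hb, hab⟩⟩
  obtain ⟨p, hp, hpmin⟩ := S.offDiag.exists_min_image (fun p => ‖ι p.1 - ι p.2‖) hne
  have hδ : 0 < ‖ι p.1 - ι p.2‖ := norm_pos_iff.2 (sub_ne_zero.2 fun h =>
    (Finset.mem_offDiag.1 hp).2.2 (hιe.injective h))
  have hlim : Filter.Tendsto (fun j : ℕ => c' * (C * D ^ j)) Filter.atTop (𝓝 0) := by
    simpa using ((tendsto_pow_atTop_nhds_zero_of_lt_one hD0 hD).const_mul C).const_mul c'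
  obtain ⟨j, hj⟩ := (hlim.eventually (gt_mem_nhds hδ)).exists
  obtain ⟨a, ha, b, hb, hab, hle⟩ := hpair j
  have := hpmin (a, b) (Finset.mem_offDiag.2 ⟨ha, hb, hab⟩)
  simp only at this
  linarith

end

/-! ### Dual forms, and smooth maps to the torus -/

section

section DualForm

variable {n k : ℕ} {M : Type*} [TopologicalSpace M] [ChartedSpace (EuclideanSpace ℝ (Fin n)) M]

/-- Smooth pointwise linearly independent vector fields on a closed manifold have a dual system of
smooth one-forms. With respect to the metric induced by an embedding into a Euclidean space, it is
given by the inverse of the Gram matrix. -/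
lemma exists_dual_form [IsManifold (𝓡 n) ∞ M] [T2Space M] [CompactSpace M]
    (s : ∀ y : M, EuclideanSpace ℝ (Fin k) →ₗ[ℝ] TangentSpace (𝓡 n) y)
    (hs : ∀ a, ContMDiff (𝓡 n) (𝓡 n).tangent ∞ (fun y => (⟨y, s y a⟩ : TangentBundle (𝓡 n) M)))
    (hinj : ∀ y, Function.Injective (s y)) :
    ∃ θ : ∀ y : M, TangentSpace (𝓡 n) y →ₗ[ℝ] EuclideanSpace ℝ (Fin k),
      ContMDiff (𝓡 n).tangent (𝓡 k) ∞ (fun z : TangentBundle (𝓡 n) M => θ z.1 z.2) ∧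
      ∀ y a, θ y (s y a) = a := by
  obtain ⟨N, ι, hι, -, hιd⟩ := exists_embedding_euclidean_of_compact (I := 𝓡 n) (M := M)
  let e : Fin k → EuclideanSpace ℝ (Fin k) := fun i => EuclideanSpace.single i 1
  let q : Fin k → M → EuclideanSpace ℝ (Fin N) := fun i y => vderiv ι y (s y (e i))
  have hq : ∀ i, ContMDiff (𝓡 n) (𝓡 N) ∞ (q i) := fun i => (contMDiff_vderiv hι).comp (hs (e i))
  -- the transpose of the derivative of the embedding along the fields
  let W : M → EuclideanSpace ℝ (Fin N) →L[ℝ] EuclideanSpace ℝ (Fin k) := fun y =>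
    ∑ i, (innerSL ℝ (q i y)).smulRight (e i)
  let G : M → EuclideanSpace ℝ (Fin k) →L[ℝ] EuclideanSpace ℝ (Fin k) := fun y =>
    ∑ i, ∑ j, (inner ℝ (q i y) (q j y)) •
      ((EuclideanSpace.proj j : EuclideanSpace ℝ (Fin k) →L[ℝ] ℝ).smulRight (e i))
  have hW : ∀ y w i, W y w i = inner ℝ (q i y) w := by
    intro y w i
    simp [W, e, Pi.single_apply]
  have hsum : ∀ y a, vderiv ι y (s y a) = ∑ j, a j • q j y := by
    intro y a
    have ha : a = ∑ j, a j • e j := by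
      ext j
      simp [e, Pi.single_apply]
    conv_lhs => rw [ha]
    simp [q]
  have hGW : ∀ y a, G y a = W y (vderiv ι y (s y a)) := by
    intro y a
    ext i
    rw [hW, hsum, inner_sum]
    simp [G, e, Pi.single_apply, inner_smul_right, mul_comm]
  have hGu : ∀ y, IsUnit (G y) := by
    intro y
    rw [ContinuousLinearMap.isUnit_iff_bijective]
    suffices hi : Function.Injective (G y) from
      ⟨hi, LinearMap.surjective_of_injective (f := (G y).toLinearMap) hi⟩
    refine (injective_iff_map_eq_zero (G y)).2 fun a ha => ?_
    have h0 : ∀ i, inner ℝ (q i y) (vderiv ι y (s y a)) = (0 : ℝ) := by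
      intro i
      rw [← hW, ← hGW, ha]
      rfl
    have h1 : vderiv ι y (s y a) = 0 := by
      rw [← inner_self_eq_zero (𝕜 := ℝ)]
      conv_lhs => rw [hsum y a, ← hsum y a]
      nth_rewrite 1 [hsum y a]
      rw [sum_inner]
      refine Finset.sum_eq_zero fun i _ => ?_
      rw [inner_smul_left, h0, mul_zero]
    have h2 : s y a = 0 := hιd y (h1.trans (map_zero (vderiv ι y)).symm)
    exact hinj y (h2.trans (map_zero _).symm)
  have hWs : ContMDiff (𝓡 n) 𝓘(ℝ, EuclideanSpace ℝ (Fin N) →L[ℝ] EuclideanSpace ℝ (Fin k)) ∞ W := by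
    refine contMDiff_finsetSum fun i _ => ?_
    have h1 : ContDiff ℝ ∞ fun v : EuclideanSpace ℝ (Fin N) =>
        (innerSL ℝ v).smulRight (e i) :=
      ContDiff.smulRight (innerSL ℝ).contDiff contDiff_const
    exact h1.contMDiff.comp (hq i)
  have hGs : ContMDiff (𝓡 n) 𝓘(ℝ, EuclideanSpace ℝ (Fin k) →L[ℝ] EuclideanSpace ℝ (Fin k)) ∞ G := by
    refine contMDiff_finsetSum fun i _ => contMDiff_finsetSum fun j _ => ?_
    have h1 : ContDiff ℝ ∞ fun v : EuclideanSpace ℝ (Fin N) × EuclideanSpace ℝ (Fin N) =>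
      inner ℝ v.1 v.2 := contDiff_fst.inner ℝ contDiff_snd
    have h2 : ContMDiff (𝓡 n) 𝓘(ℝ, ℝ) ∞ fun y => inner ℝ (q i y) (q j y) :=
      h1.contMDiff.comp ((hq i).prodMk_space (hq j))
    exact h2.smul contMDiff_const
  have hGi : ContMDiff (𝓡 n) 𝓘(ℝ, EuclideanSpace ℝ (Fin k) →L[ℝ] EuclideanSpace ℝ (Fin k)) ∞
      (fun y => Ring.inverse (G y)) := by
    intro y
    obtain ⟨u, hu⟩ := hGu y
    have h1 : ContDiffAt ℝ ∞ Ring.inverse (G y) := hu ▸ contDiffAt_ringInverse ℝ u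
    exact h1.contMDiffAt.comp y (hGs y)
  refine ⟨fun y => ((Ring.inverse (G y)).comp ((W y).comp (vderiv ι y))).toLinearMap, ?_, ?_⟩
  · have hpr : ContMDiff (𝓡 n).tangent (𝓡 n) ∞ (fun z : TangentBundle (𝓡 n) M => z.1) :=
      contMDiff_proj _
    exact (hGi.comp hpr).clm_apply ((hWs.comp hpr).clm_apply (contMDiff_vderiv hι))
  · intro y a
    change Ring.inverse (G y) (W y (vderiv ι y (s y a))) = a
    rw [← hGW]
    exact congrFun (congrArg DFunLike.coe (Ring.inverse_mul_cancel _ (hGu y))) a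

end DualForm

section Torus

lemma contMDiff_torus {k : ℕ} {HN EN : Type*} [NormedAddCommGroup EN] [NormedSpace ℝ EN]
    [TopologicalSpace HN] {J : ModelWithCorners ℝ EN HN} {N : Type*} [TopologicalSpace N]
    [ChartedSpace HN N] {h : N → Torus k}
    (hh : ∀ j, ContMDiff J (𝓡 1) ∞ (fun x => h x j)) : ContMDiff J (torusModel k) ∞ h := by
  intro x
  rw [contMDiffAt_iff]
  refine ⟨continuousAt_pi.2 fun j => (hh j).continuous.continuousAt, ?_⟩
  rw [contDiffWithinAt_pi]
  intro j
  exact (contMDiffAt_iff.1 (hh j x)).2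

lemma contMDiff_torus_eval {k : ℕ} (j : Fin k) :
    ContMDiff (torusModel k) (𝓡 1) ∞ (fun t : Torus k => t j) := by
  intro t
  rw [contMDiffAt_iff]
  refine ⟨(continuous_apply j).continuousAt, ?_⟩
  have h1 : ContDiffWithinAt ℝ ∞ (fun w : Fin k → EuclideanSpace ℝ (Fin 1) => w j)
    (range (torusModel k)) (extChartAt (torusModel k) t t) :=
    (contDiff_apply ℝ (EuclideanSpace ℝ (Fin 1)) j).contDiffWithinAt
  refine h1.congr_of_eventuallyEq ?_ ?_
  · filter_upwards [extChartAt_target_mem_nhdsWithin t] with w hw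
    have h2 : w j ∈ (extChartAt (𝓡 1) (t j)).target := by
      rw [extChartAt_target] at hw ⊢
      exact ⟨hw.1 j (mem_univ j), by simp⟩
    exact (extChartAt (𝓡 1) (t j)).right_inv h2
  · simp only [Function.comp, extChartAt_to_inv]
    rfl

attribute [local instance] finrank_real_complex_fact' in
lemma contMDiff_circle_coe : ContMDiff (𝓡 1) 𝓘(ℝ, ℂ) ∞ (fun c : Circle => (c : ℂ)) :=
  contMDiff_coe_sphere

lemma contMDiff_torusExp (k : ℕ) : ContMDiff (𝓡 k) (torusModel k) ∞ (torusExp k) := by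
  refine contMDiff_torus fun j => ?_
  have h : ContDiff ℝ ∞ fun v : EuclideanSpace ℝ (Fin k) => 2 * Real.pi * v j :=
    contDiff_const.mul (EuclideanSpace.proj j : EuclideanSpace ℝ (Fin k) →L[ℝ] ℝ).contDiff
  exact contMDiff_circleExp.comp h.contMDiff

lemma torusExp_zero (k : ℕ) : torusExp k 0 = 1 := by
  ext j
  simp [torusExp]

end Torus

end

/-! ### Torus automorphisms and the fundamental vector fields of a torus action -/

section

variable {k b d : ℕ} {X : Type*} {E : Type*}
  [TopologicalSpace X] [ChartedSpace (EuclideanSpace ℝ (Fin b)) X]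
  [TopologicalSpace E] [ChartedSpace (EuclideanSpace ℝ (Fin d)) E] [MulAction (Torus k) E]

section Automorphism

lemma realLin_apply (A : Matrix.SpecialLinearGroup (Fin k) ℤ) (v : EuclideanSpace ℝ (Fin k))
    (i : Fin k) : realLin A v i = ∑ j, (A.1 i j : ℝ) * v j := by
  simp [realLin, Matrix.toLpLin_apply, Matrix.mulVec, dotProduct]

lemma realLin_mul (A B : Matrix.SpecialLinearGroup (Fin k) ℤ) (v : EuclideanSpace ℝ (Fin k)) :
    realLin (A * B) v = realLin A (realLin B v) := by
  ext i
  simp only [realLin_apply, Matrix.SpecialLinearGroup.coe_mul, Matrix.mul_apply, Int.cast_sum,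
    Int.cast_mul, Finset.sum_mul, Finset.mul_sum]
  rw [Finset.sum_comm]
  exact Finset.sum_congr rfl fun j _ => Finset.sum_congr rfl fun l _ => by ring

lemma realLin_one (v : EuclideanSpace ℝ (Fin k)) : realLin 1 v = v := by
  ext i
  simp [realLin_apply, Matrix.one_apply]

lemma torusAut_torusExp (A : Matrix.SpecialLinearGroup (Fin k) ℤ)
    (v : EuclideanSpace ℝ (Fin k)) : torusAut A (torusExp k v) = torusExp k (realLin A v) := by
  funext i
  simp only [torusAut, torusExp, realLin_apply, ← Circle.exp_zsmul]
  rw [Finset.mul_sum]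
  have : ∀ s : Finset (Fin k), ∏ j ∈ s, Circle.exp (A.1 i j • (2 * Real.pi * v j)) =
      Circle.exp (∑ j ∈ s, 2 * Real.pi * ((A.1 i j : ℝ) * v j)) := by
    intro s
    induction s using Finset.induction_on with
    | empty => simp
    | insert j s hj ih =>
      rw [Finset.prod_insert hj, Finset.sum_insert hj, ih, Circle.exp_add]
      congr 2
      rw [zsmul_eq_mul]
      ring
  exact this _

lemma torusExp_surjective (k : ℕ) : Function.Surjective (torusExp k) := by
  intro t
  choose r hr using fun j => Circle.exp_surjective (t j)
  refine ⟨WithLp.toLp 2 fun j => r j / (2 * Real.pi), ?_⟩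
  funext j
  rw [← hr]
  simp only [torusExp]
  congr 1
  field_simp

lemma torusAut_mul (A B : Matrix.SpecialLinearGroup (Fin k) ℤ) (t : Torus k) :
    torusAut (A * B) t = torusAut A (torusAut B t) := by
  obtain ⟨v, rfl⟩ := torusExp_surjective k t
  simp only [torusAut_torusExp, realLin_mul]

lemma torusAut_one (t : Torus k) : torusAut 1 t = t := by
  obtain ⟨v, rfl⟩ := torusExp_surjective k t
  rw [torusAut_torusExp, realLin_one]

lemma torusAut_bijective (A : Matrix.SpecialLinearGroup (Fin k) ℤ) :
    Function.Bijective (torusAut A) :=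
  Function.bijective_iff_has_inverse.2 ⟨torusAut A⁻¹,
    fun t => by rw [← torusAut_mul, inv_mul_cancel, torusAut_one],
    fun t => by rw [← torusAut_mul, mul_inv_cancel, torusAut_one]⟩

end Automorphism

section Orbit

/-- Points of the tangent bundle with equal base points and equal coordinate vectors agree. -/
lemma tangentBundle_mk_congr {x y : E} (h : x = y) (v : EuclideanSpace ℝ (Fin d)) :
    (⟨x, v⟩ : TangentBundle (𝓡 d) E) = ⟨y, v⟩ := by
  subst h; rfl

lemma contMDiff_orbitMap (h : ContMDiffSMul (torusModel k) (𝓡 d) ∞ (Torus k) E) :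
    ContMDiff ((𝓡 k).prod (𝓡 d)) (𝓡 d) ∞
      (fun q : EuclideanSpace ℝ (Fin k) × E => torusExp k q.1 • q.2) :=
  h.contMDiff_smul.comp (((contMDiff_torusExp k).comp contMDiff_fst).prodMk contMDiff_snd)

lemma contMDiff_orbit (h : ContMDiffSMul (torusModel k) (𝓡 d) ∞ (Torus k) E) (y : E) :
    ContMDiff (𝓡 k) (𝓡 d) ∞ (fun v : EuclideanSpace ℝ (Fin k) => torusExp k v • y) :=
  (contMDiff_orbitMap h).comp (contMDiff_id.prodMk contMDiff_const)

lemma torusExp_zero_smul {E : Type*} [MulAction (Torus k) E] (y : E) : torusExp k 0 • y = y := by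
  rw [torusExp_zero, one_smul]

/-- The chain rule for a map restricted to an orbit. The target tangent spaces at the equal points
`G (torusExp k 0 • y)` and `G y` are identified through the model vector space. -/
lemma mfderiv_comp_orbit (h : ContMDiffSMul (torusModel k) (𝓡 d) ∞ (Torus k) E)
    {HN EN : Type*} [NormedAddCommGroup EN] [NormedSpace ℝ EN] [TopologicalSpace HN]
    {J : ModelWithCorners ℝ EN HN} {N : Type*} [TopologicalSpace N] [ChartedSpace HN N]
    {G : E → N} {y : E} (hG : MDifferentiableAt (𝓡 d) J G y) (v : EuclideanSpace ℝ (Fin k)) :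
    (id (mfderiv (𝓡 k) J (fun v : EuclideanSpace ℝ (Fin k) => G (torusExp k v • y)) 0 v) : EN) =
      mfderiv (𝓡 d) J G y (orbitDeriv k y v) := by
  have h1 := mfderiv_comp_of_eq (I := 𝓡 k) (I' := 𝓡 d) (I'' := J) hG
    ((contMDiff_orbit h y).mdifferentiableAt (x := 0) (by simp)) (torusExp_zero_smul (k := k) y)
  have h2 : ∀ {x : E} (_ : x = y) (w : EuclideanSpace ℝ (Fin d)),
      (id (mfderiv (𝓡 d) J G x w) : EN) = mfderiv (𝓡 d) J G y w := by
    rintro x rfl w; rfl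
  exact (congrFun (congrArg DFunLike.coe h1) v).trans (h2 (torusExp_zero_smul y) _)

lemma contMDiff_orbitDeriv [IsManifold (𝓡 d) ∞ E]
    (h : ContMDiffSMul (torusModel k) (𝓡 d) ∞ (Torus k) E) :
    ContMDiff ((𝓡 d).prod (𝓡 k)) (𝓡 d).tangent ∞
      (fun q : E × EuclideanSpace ℝ (Fin k) =>
        (⟨q.1, orbitDeriv k q.1 q.2⟩ : TangentBundle (𝓡 d) E)) := by
  let Θ : EuclideanSpace ℝ (Fin k) × E → E := fun q => torusExp k q.1 • q.2
  have hΘ : ContMDiff ((𝓡 k).prod (𝓡 d)) (𝓡 d) ∞ Θ := contMDiff_orbitMap h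
  have h1 : ContMDiff ((𝓡 k).prod (𝓡 d)).tangent (𝓡 d).tangent ∞
      (tangentMap ((𝓡 k).prod (𝓡 d)) (𝓡 d) Θ) := hΘ.contMDiff_tangentMap (by rfl)
  have h2 : ContMDiff ((𝓡 d).prod (𝓡 k)) (𝓡 k).tangent ∞
      (fun q : E × EuclideanSpace ℝ (Fin k) =>
        (⟨0, q.2⟩ : TangentBundle (𝓡 k) (EuclideanSpace ℝ (Fin k)))) := by
    have h3 : ContMDiff ((𝓡 d).prod (𝓡 k)) ((𝓡 k).prod (𝓡 k)) ∞
      (fun q : E × EuclideanSpace ℝ (Fin k) => ((0 : EuclideanSpace ℝ (Fin k)), q.2)) :=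
      contMDiff_const.prodMk contMDiff_snd
    rw [chartedSpaceSelf_prod] at h3
    exact (contMDiff_tangentBundleModelSpaceHomeomorph_symm (I := 𝓡 k)).comp h3
  have h3 : ContMDiff ((𝓡 d).prod (𝓡 k)) (𝓡 d).tangent ∞
      (fun q : E × EuclideanSpace ℝ (Fin k) => (⟨q.1, 0⟩ : TangentBundle (𝓡 d) E)) :=
    (Bundle.contMDiff_zeroSection ℝ (TangentSpace (𝓡 d) : E → Type _)).comp contMDiff_fst
  have h4 := h1.comp ((contMDiff_equivTangentBundleProd_symm (I := 𝓡 k) (I' := 𝓡 d)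
    (M := EuclideanSpace ℝ (Fin k)) (M' := E) (n := ∞)).comp (h2.prodMk h3))
  refine h4.congr fun q => ?_
  obtain ⟨y, v⟩ := q
  have h5 : (id (orbitDeriv k y v) : EuclideanSpace ℝ (Fin d)) =
      mfderiv ((𝓡 k).prod (𝓡 d)) (𝓡 d) Θ (0, y) (v, 0) := by
    have h6 := mfderiv_prod_eq_add_apply (f := Θ) (p := ((0 : EuclideanSpace ℝ (Fin k)), y))
      (v := (v, (0 : EuclideanSpace ℝ (Fin d))))
      (hΘ.mdifferentiableAt (x := ((0 : EuclideanSpace ℝ (Fin k)), y)) (by simp))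
    have h7 : mfderiv (𝓡 d) (𝓡 d) (fun z : E => Θ (0, z)) y (0 : EuclideanSpace ℝ (Fin d)) = 0 :=
      map_zero _
    exact ((h6.trans (congrArg _ h7)).trans (add_zero _)).symm
  have h6 := tangentBundle_mk_congr (d := d) (torusExp_zero_smul (k := k) y)
    (id (orbitDeriv k y v) : EuclideanSpace ℝ (Fin d))
  refine h6.symm.trans ?_
  rw [h5]
  rfl

end Orbit

end

/-! ### Geometry of principal torus bundles and of their maps -/

section

variable {k b d : ℕ} {X : Type*} {E : Type*}
  [TopologicalSpace X] [ChartedSpace (EuclideanSpace ℝ (Fin b)) X]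
  [TopologicalSpace E] [ChartedSpace (EuclideanSpace ℝ (Fin d)) E] [MulAction (Torus k) E]
  {p : E → X}

lemma IsPrincipalTorusBundle.surjective
    (hp : IsPrincipalTorusBundle (k := k) (b := b) (d := d) p) : Function.Surjective p := by
  intro x
  obtain ⟨e, hx, -⟩ := hp.exists_trivialization x
  exact ⟨e.toOpenPartialHomeomorph.symm (x, 1), e.proj_symm_apply' hx⟩

lemma IsPrincipalTorusBundle.exists_smul_eq
    (hp : IsPrincipalTorusBundle (k := k) (b := b) (d := d) p) {y z : E} (h : p y = p z) :
    ∃ t : Torus k, t • y = z := by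
  obtain ⟨e, hx, -, -, he⟩ := hp.exists_trivialization (p y)
  have hy : y ∈ e.source := e.mem_source.2 hx
  have hz : z ∈ e.source := e.mem_source.2 (h ▸ hx)
  have ht : (((e y).2)⁻¹ * (e z).2) • y ∈ e.source :=
    e.mem_source.2 (by rw [hp.proj_smul]; exact hx)
  refine ⟨((e y).2)⁻¹ * (e z).2, e.injOn ht hz ?_⟩
  refine (he _ y hy).trans ?_
  rw [mul_inv_cancel_left, e.coe_fst hy, h, ← e.coe_fst hz]
  rfl

lemma IsPrincipalTorusBundle.eq_one_of_smul_eq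
    (hp : IsPrincipalTorusBundle (k := k) (b := b) (d := d) p) {t : Torus k} {y : E}
    (h : t • y = y) : t = 1 := by
  obtain ⟨e, hx, -, -, he⟩ := hp.exists_trivialization (p y)
  have h1 := he t y (e.mem_source.2 hx)
  rw [h] at h1
  exact mul_eq_left.1 (congrArg Prod.snd h1).symm

/-- The total space of a principal torus bundle over a compact base is compact. -/
lemma IsPrincipalTorusBundle.compactSpace [T2Space X] [CompactSpace X]
    (hp : IsPrincipalTorusBundle (k := k) (b := b) (d := d) p) : CompactSpace E := by
  choose e hx _ _ _ using hp.exists_trivialization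
  have hK := fun x => local_compact_nhds ((e x).open_baseSet.mem_nhds (hx x))
  choose K hKx hKe hKc using hK
  obtain ⟨t, ht⟩ := CompactSpace.elim_nhds_subcover K hKx
  refine ⟨?_⟩
  have hc : IsCompact (⋃ x ∈ t, (e x).toOpenPartialHomeomorph.symm '' (K x ×ˢ univ)) :=
    t.isCompact_biUnion fun x _ => ((hKc x).prod isCompact_univ).image_of_continuousOn
      ((e x).toOpenPartialHomeomorph.continuousOn_symm.mono fun q hq =>
        (e x).mem_target.2 (hKe x hq.1))
  refine hc.of_isClosed_subset isClosed_univ fun y _ => ?_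
  have hy : p y ∈ ⋃ x ∈ t, K x := ht ▸ mem_univ _
  obtain ⟨x, hxt, hyx⟩ := mem_iUnion₂.1 hy
  refine mem_iUnion₂.2 ⟨x, hxt, e x y, ⟨?_, mem_univ _⟩, ?_⟩
  · rw [(e x).coe_fst' (hKe x hyx)]
    exact hyx
  · exact (e x).toOpenPartialHomeomorph.left_inv ((e x).mem_source.2 (hKe x hyx))

lemma IsAMap.bijective (hp : IsPrincipalTorusBundle (k := k) (b := b) (d := d) p)
    {A : Matrix.SpecialLinearGroup (Fin k) ℤ} {f : X → X} (hf : Function.Bijective f) {F : E → E}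
    (hF : IsAMap (d := d) A p f F) : Function.Bijective F := by
  constructor
  · intro y z h
    obtain ⟨t, rfl⟩ := hp.exists_smul_eq (hf.1 (by rw [← hF.covers, ← hF.covers, h]) : p y = p z)
    rw [hF.map_smul] at h
    have h1 := hp.eq_one_of_smul_eq h.symm
    have h2 : torusAut A (1 : Torus k) = 1 := by
      funext i
      simp [torusAut]
    rw [(torusAut_bijective A).1 (h1.trans h2.symm), one_smul]
  · intro z
    obtain ⟨x, hx⟩ := hf.2 (p z)
    obtain ⟨y, rfl⟩ := hp.surjective x
    obtain ⟨t, ht⟩ := hp.exists_smul_eq ((hF.covers y).trans hx : p (F y) = p z)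
    obtain ⟨s, rfl⟩ := (torusAut_bijective A).2 t
    exact ⟨s • y, by rw [hF.map_smul, ht]⟩

lemma IsPrincipalTorusBundle.mfderiv_orbitDeriv
    (hp : IsPrincipalTorusBundle (k := k) (b := b) (d := d) p) (y : E)
    (v : EuclideanSpace ℝ (Fin k)) : mfderiv (𝓡 d) (𝓡 b) p y (orbitDeriv k y v) = 0 := by
  have h := mfderiv_comp_orbit hp.contMDiff_smul
    (hp.contMDiff_proj.mdifferentiableAt (x := y) (by simp)) v
  have h2 : (fun v : EuclideanSpace ℝ (Fin k) => p (torusExp k v • y)) = fun _ => p y :=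
    funext fun v => hp.proj_smul _ _
  rw [h2, mfderiv_const] at h
  exact h.symm

/-- The derivative of an `A`-map is given by the matrix `A` along the fibers. -/
lemma IsAMap.mfderiv_orbitDeriv (hp : IsPrincipalTorusBundle (k := k) (b := b) (d := d) p)
    {A : Matrix.SpecialLinearGroup (Fin k) ℤ} {f : X → X} {F : E → E}
    (hF : IsAMap (d := d) A p f F) (y : E) (v : EuclideanSpace ℝ (Fin k)) :
    mfderiv (𝓡 d) (𝓡 d) F y (orbitDeriv k y v) = orbitDeriv k (F y) (realLin A v) := by
  have h := mfderiv_comp_orbit hp.contMDiff_smul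
    (hF.contMDiff.mdifferentiableAt (x := y) (by simp)) v
  let A' : EuclideanSpace ℝ (Fin k) →L[ℝ] EuclideanSpace ℝ (Fin k) :=
    LinearMap.toContinuousLinearMap (realLin A)
  have h2 : (fun v : EuclideanSpace ℝ (Fin k) => F (torusExp k v • y)) =
      (fun v => torusExp k v • F y) ∘ A' :=
    funext fun v => by rw [hF.map_smul, torusAut_torusExp]; rfl
  have h3 := mfderiv_comp_of_eq (I := 𝓡 k) (I' := 𝓡 k) (I'' := 𝓡 d) (x := 0)
    ((contMDiff_orbit hp.contMDiff_smul (F y)).mdifferentiableAt (x := 0) (by simp))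
    (A'.differentiableAt.mdifferentiableAt) (map_zero A')
  rw [h2, h3, ContinuousLinearMap.mfderiv_eq] at h
  refine h.symm.trans ?_
  have h4 : ∀ {x : EuclideanSpace ℝ (Fin k)} (_ : x = 0) (w : EuclideanSpace ℝ (Fin k)),
      (id (mfderiv (𝓡 k) (𝓡 d) (fun v => torusExp k v • F y) x w) : EuclideanSpace ℝ (Fin d)) =
      mfderiv (𝓡 k) (𝓡 d) (fun v => torusExp k v • F y) 0 w := by
    rintro x rfl w; rfl
  exact h4 (map_zero A') _

/-- The action of the torus on the total space is locally free. -/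
lemma IsPrincipalTorusBundle.orbitDeriv_injective
    (hp : IsPrincipalTorusBundle (k := k) (b := b) (d := d) p) (y : E) :
    Function.Injective (orbitDeriv k y : _ →ₗ[ℝ] TangentSpace (𝓡 d) y) := by
  refine (injective_iff_map_eq_zero _).2 fun v hv => ?_
  obtain ⟨e, hx, hes, -, he⟩ := hp.exists_trivialization (p y)
  have hy : y ∈ e.source := e.mem_source.2 hx
  ext j
  -- the `j`-th circle coordinate of the trivialization
  let Q : E → ℂ := fun z => ((e z).2 j : Circle)
  have hQ : MDifferentiableAt (𝓡 d) 𝓘(ℝ, ℂ) Q y := by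
    have h1 : ContMDiffAt (𝓡 d) ((𝓡 b).prod (torusModel k)) ∞ e y :=
      hes.contMDiffAt (e.open_source.mem_nhds hy)
    have h2 : ContMDiff ((𝓡 b).prod (torusModel k)) 𝓘(ℝ, ℂ) ∞
      (fun q : X × Torus k => ((q.2 j : Circle) : ℂ)) :=
      contMDiff_circle_coe.comp ((contMDiff_torus_eval j).comp contMDiff_snd)
    exact (h2.contMDiffAt.comp y h1).mdifferentiableAt (by simp)
  have h := mfderiv_comp_orbit hp.contMDiff_smul hQ v
  rw [hv] at h
  have hQe : (fun v : EuclideanSpace ℝ (Fin k) => Q (torusExp k v • y)) =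
      fun v => Q y * Complex.exp (((2 * Real.pi * v j : ℝ) : ℂ) * Complex.I) := by
    funext v
    simp only [Q]
    rw [he _ y hy]
    simp [torusExp, Circle.coe_exp]
  have hd : HasFDerivAt (fun v : EuclideanSpace ℝ (Fin k) =>
      Q y * Complex.exp (((2 * Real.pi * v j : ℝ) : ℂ) * Complex.I))
      (Q y • (Complex.exp (((2 * Real.pi * (0 : EuclideanSpace ℝ (Fin k)) j : ℝ) : ℂ) *
        Complex.I) • (Complex.I • Complex.ofRealCLM.comp ((2 * Real.pi) •
          (EuclideanSpace.proj j : EuclideanSpace ℝ (Fin k) →L[ℝ] ℝ))))) 0 := by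
    have h1 : HasFDerivAt (fun v : EuclideanSpace ℝ (Fin k) => 2 * Real.pi * v j)
      ((2 * Real.pi) • (EuclideanSpace.proj j : EuclideanSpace ℝ (Fin k) →L[ℝ] ℝ)) 0 :=
      (EuclideanSpace.proj j : EuclideanSpace ℝ (Fin k) →L[ℝ] ℝ).hasFDerivAt.const_mul _
    have h2 := Complex.ofRealCLM.hasFDerivAt.comp (0 : EuclideanSpace ℝ (Fin k)) h1
    exact ((h2.mul_const Complex.I).cexp).const_mul (Q y)
  rw [hQe, mfderiv_eq_fderiv, hd.fderiv] at h
  have h0 : (mfderiv (𝓡 d) 𝓘(ℝ, ℂ) Q y) (0 : TangentSpace (𝓡 d) y) = (0 : ℂ) := map_zero _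
  have h' : Q y * (Complex.exp (((2 * Real.pi * (0 : EuclideanSpace ℝ (Fin k)) j : ℝ) : ℂ) *
        Complex.I) * (Complex.I * ((2 * Real.pi * v j : ℝ) : ℂ))) = 0 := h.trans h0
  have hQ0 : Q y ≠ 0 := Circle.coe_ne_zero _
  simpa [hQ0, Complex.exp_ne_zero, Real.pi_ne_zero] using h'

lemma IsPrincipalTorusBundle.mfderiv_surjective
    (hp : IsPrincipalTorusBundle (k := k) (b := b) (d := d) p) (y : E) :
    Function.Surjective (mfderiv (𝓡 d) (𝓡 b) p y) := by
  obtain ⟨e, hx, -, hes, -⟩ := hp.exists_trivialization (p y)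
  have hy : y ∈ e.source := e.mem_source.2 hx
  let σ : X → E := fun x => e.toOpenPartialHomeomorph.symm (x, (e y).2)
  have hσy : σ (p y) = y := e.symm_apply_mk_proj hy
  have hσ : MDifferentiableAt (𝓡 b) (𝓡 d) σ (p y) := by
    have h1 : ContMDiffAt ((𝓡 b).prod (torusModel k)) (𝓡 d) ∞
      e.toOpenPartialHomeomorph.symm (p y, (e y).2) :=
      hes.contMDiffAt (e.open_target.mem_nhds (e.mem_target.2 hx))
    have h2 : ContMDiffAt (𝓡 b) ((𝓡 b).prod (torusModel k)) ∞ (fun x => (x, (e y).2)) (p y) :=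
      contMDiffAt_id.prodMk contMDiffAt_const
    exact (h1.comp (p y) h2).mdifferentiableAt (by simp)
  have h1 := mfderiv_comp_of_eq (I := 𝓡 b) (I' := 𝓡 d) (I'' := 𝓡 b)
    (hp.contMDiff_proj.mdifferentiableAt (x := y) (by simp)) hσ hσy
  have h2 : p ∘ σ =ᶠ[𝓝 (p y)] id := by
    filter_upwards [e.open_baseSet.mem_nhds hx] with x hx
    exact e.proj_symm_apply' hx
  rw [h2.mfderiv_eq, mfderiv_id] at h1
  intro w
  have h4 : ∀ {z : E} (_ : z = y) (w : EuclideanSpace ℝ (Fin d)),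
      (id (mfderiv (𝓡 d) (𝓡 b) p z w) : EuclideanSpace ℝ (Fin b)) =
        mfderiv (𝓡 d) (𝓡 b) p y w := by
    rintro z rfl w; rfl
  refine ⟨mfderiv (𝓡 b) (𝓡 d) σ (p y) w, ?_⟩
  exact (h4 hσy _).symm.trans (congrFun (congrArg DFunLike.coe h1) w).symm

/-- The vertical bundle is the tangent bundle of the orbits. -/
lemma IsPrincipalTorusBundle.range_orbitDeriv
    (hp : IsPrincipalTorusBundle (k := k) (b := b) (d := d) p) (hd : d = b + k) (y : E) :
    LinearMap.range (orbitDeriv k y : _ →ₗ[ℝ] TangentSpace (𝓡 d) y) = vertical b d p y := by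
  have hfd : FiniteDimensional ℝ (TangentSpace (𝓡 d) y) :=
    inferInstanceAs (FiniteDimensional ℝ (EuclideanSpace ℝ (Fin d)))
  have hfb : FiniteDimensional ℝ (TangentSpace (𝓡 b) (p y)) :=
    inferInstanceAs (FiniteDimensional ℝ (EuclideanSpace ℝ (Fin b)))
  have hrd : Module.finrank ℝ (TangentSpace (𝓡 d) y) = d :=
    finrank_euclideanSpace_fin (𝕜 := ℝ) (n := d)
  have hrb : Module.finrank ℝ (TangentSpace (𝓡 b) (p y)) = b :=
    finrank_euclideanSpace_fin (𝕜 := ℝ) (n := b)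
  apply Submodule.eq_of_le_of_finrank_eq
  · rintro _ ⟨v, rfl⟩
    exact hp.mfderiv_orbitDeriv y v
  · have h1 := LinearMap.finrank_range_of_inj (hp.orbitDeriv_injective y)
    have h2 := (mfderiv (𝓡 d) (𝓡 b) p y).toLinearMap.finrank_range_add_finrank_ker
    have h3 : LinearMap.range (mfderiv (𝓡 d) (𝓡 b) p y).toLinearMap = ⊤ :=
      LinearMap.range_eq_top.2 (hp.mfderiv_surjective y)
    rw [h3, finrank_top, hrd, hrb] at h2
    rw [h1, finrank_euclideanSpace_fin]
    have h4 : Module.finrank ℝ (vertical b d p y) =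
      Module.finrank ℝ (LinearMap.ker (mfderiv (𝓡 d) (𝓡 b) p y).toLinearMap) := rfl
    omega

/-- The derivative of an `A`-map covers the derivative of the map of the base. The tangent spaces at
the equal points `p (F y)` and `f (p y)` are identified through the model vector space. -/
lemma IsAMap.mfderiv_covers (hp : IsPrincipalTorusBundle (k := k) (b := b) (d := d) p)
    {A : Matrix.SpecialLinearGroup (Fin k) ℤ} {f : X → X} {F : E → E}
    (hf : ContMDiff (𝓡 b) (𝓡 b) ∞ f) (hF : IsAMap (d := d) A p f F) (y : E)
    (v : TangentSpace (𝓡 d) y) :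
    (id (mfderiv (𝓡 d) (𝓡 b) p (F y) (mfderiv (𝓡 d) (𝓡 d) F y v)) : EuclideanSpace ℝ (Fin b)) =
      mfderiv (𝓡 b) (𝓡 b) f (p y) (mfderiv (𝓡 d) (𝓡 b) p y v) := by
  have h1 : p ∘ F = f ∘ p := funext hF.covers
  have h2 := mfderiv_comp y (hp.contMDiff_proj.mdifferentiableAt (x := F y) (by simp))
    (hF.contMDiff.mdifferentiableAt (x := y) (by simp))
  have h3 := mfderiv_comp y (hf.mdifferentiableAt (x := p y) (by simp))
    (hp.contMDiff_proj.mdifferentiableAt (x := y) (by simp))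
  rw [h1] at h2
  exact congrFun (congrArg DFunLike.coe (h2.symm.trans h3)) v

end

/-! ### Linear growth rates, splittings and derivative bounds on the base -/

section

section Linear

variable {k : ℕ} (A : Matrix.SpecialLinearGroup (Fin k) ℤ)

lemma norm_realLin_le_linMax {V : Submodule ℝ (EuclideanSpace ℝ (Fin k))}
    {v : EuclideanSpace ℝ (Fin k)} (hv : v ∈ V) : ‖realLin A v‖ ≤ linMax A V * ‖v‖ := by
  by_cases h0 : v = 0
  · simp [h0]
  have hn : 0 < ‖v‖ := norm_pos_iff.2 h0
  have hbdd : BddAbove {r | ∃ v ∈ V, ‖v‖ = 1 ∧ r = ‖realLin A v‖} := by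
    refine ⟨‖LinearMap.toContinuousLinearMap (realLin A)‖, ?_⟩
    rintro _ ⟨w, -, hw, rfl⟩
    simpa [hw] using (LinearMap.toContinuousLinearMap (realLin A)).le_opNorm w
  have h1 : ‖realLin A (‖v‖⁻¹ • v)‖ ≤ linMax A V :=
    le_csSup hbdd ⟨_, V.smul_mem _ hv, by simp [norm_smul, hn.ne'], rfl⟩
  rw [map_smul, norm_smul, norm_inv, norm_norm, inv_mul_le_iff₀ hn] at h1
  linarith

lemma linMin_le_norm_realLin {V : Submodule ℝ (EuclideanSpace ℝ (Fin k))}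
    {v : EuclideanSpace ℝ (Fin k)} (hv : v ∈ V) : linMin A V * ‖v‖ ≤ ‖realLin A v‖ := by
  by_cases h0 : v = 0
  · simp [h0]
  have hn : 0 < ‖v‖ := norm_pos_iff.2 h0
  have hbdd : BddBelow {r | ∃ v ∈ V, ‖v‖ = 1 ∧ r = ‖realLin A v‖} := by
    refine ⟨0, ?_⟩
    rintro _ ⟨w, -, hw, rfl⟩
    exact norm_nonneg _
  have h1 : linMin A V ≤ ‖realLin A (‖v‖⁻¹ • v)‖ :=
    csInf_le hbdd ⟨_, V.smul_mem _ hv, by simp [norm_smul, hn.ne'], rfl⟩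
  rw [map_smul, norm_smul, norm_inv, norm_norm, le_inv_mul_iff₀ hn] at h1
  linarith

lemma linMax_nonneg (V : Submodule ℝ (EuclideanSpace ℝ (Fin k))) : 0 ≤ linMax A V := by
  refine Real.sSup_nonneg ?_
  rintro _ ⟨w, -, -, rfl⟩
  exact norm_nonneg _

lemma realLin_inv_apply (v : EuclideanSpace ℝ (Fin k)) : realLin A⁻¹ (realLin A v) = v := by
  rw [← realLin_mul, inv_mul_cancel, realLin_one]

lemma realLin_apply_inv (v : EuclideanSpace ℝ (Fin k)) : realLin A (realLin A⁻¹ v) = v := by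
  rw [← realLin_mul, mul_inv_cancel, realLin_one]

lemma realLin_inv_mem {V : Submodule ℝ (EuclideanSpace ℝ (Fin k))} (hV : V.map (realLin A) = V)
    {v : EuclideanSpace ℝ (Fin k)} (hv : v ∈ V) : realLin A⁻¹ v ∈ V := by
  rw [← hV] at hv
  obtain ⟨w, hw, rfl⟩ := hv
  rwa [realLin_inv_apply]

/-- The three projections of a splitting. -/
lemma IsSplitting.exists_projections {Es Ec Eu : Submodule ℝ (EuclideanSpace ℝ (Fin k))}
    (h : IsSplitting Es Ec Eu) :
    ∃ Ps Pc Pu : EuclideanSpace ℝ (Fin k) →ₗ[ℝ] EuclideanSpace ℝ (Fin k),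
      (∀ v, Ps v ∈ Es) ∧ (∀ v, Pc v ∈ Ec) ∧ (∀ v, Pu v ∈ Eu) ∧
      (∀ v ∈ Es, Ps v = v ∧ Pc v = 0 ∧ Pu v = 0) ∧ (∀ v ∈ Ec, Ps v = 0 ∧ Pc v = v ∧ Pu v = 0) ∧
      (∀ v ∈ Eu, Ps v = 0 ∧ Pc v = 0 ∧ Pu v = v) ∧ ∀ v, Ps v + Pc v + Pu v = v := by
  obtain ⟨h1, h2⟩ := h
  have htop : Es ⊔ Ec ⊔ Eu = ⊤ := h2.sup_eq_top
  have hs : IsCompl Es (Ec ⊔ Eu) :=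
    ⟨h1.disjoint_sup_right_of_disjoint_sup_left h2.disjoint,
      codisjoint_iff.2 (by rw [← sup_assoc, htop])⟩
  have hc : IsCompl Ec (Es ⊔ Eu) :=
    ⟨h1.symm.disjoint_sup_right_of_disjoint_sup_left (by rw [sup_comm]; exact h2.disjoint),
      codisjoint_iff.2 (by rw [← sup_assoc, sup_comm Ec, htop])⟩
  have hEs : ∀ v ∈ Es, Es.projection _ hs v = v ∧ Ec.projection _ hc v = 0 ∧
      Eu.projection _ h2.symm v = 0 := fun v hv =>
    ⟨Submodule.projection_apply_of_mem_left hs hv,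
      (Submodule.projection_apply_eq_zero_iff hc).2 (Submodule.mem_sup_left hv),
      (Submodule.projection_apply_eq_zero_iff h2.symm).2 (Submodule.mem_sup_left hv)⟩
  have hEc : ∀ v ∈ Ec, Es.projection _ hs v = 0 ∧ Ec.projection _ hc v = v ∧
      Eu.projection _ h2.symm v = 0 := fun v hv =>
    ⟨(Submodule.projection_apply_eq_zero_iff hs).2 (Submodule.mem_sup_left hv),
      Submodule.projection_apply_of_mem_left hc hv,
      (Submodule.projection_apply_eq_zero_iff h2.symm).2 (Submodule.mem_sup_right hv)⟩
  have hEu : ∀ v ∈ Eu, Es.projection _ hs v = 0 ∧ Ec.projection _ hc v = 0 ∧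
      Eu.projection _ h2.symm v = v := fun v hv =>
    ⟨(Submodule.projection_apply_eq_zero_iff hs).2 (Submodule.mem_sup_right hv),
      (Submodule.projection_apply_eq_zero_iff hc).2 (Submodule.mem_sup_right hv),
      Submodule.projection_apply_of_mem_left h2.symm hv⟩
  refine ⟨Es.projection _ hs, Ec.projection _ hc, Eu.projection _ h2.symm,
    fun v => Submodule.projection_apply_mem _ _,
    fun v => Submodule.projection_apply_mem _ _,
    fun v => Submodule.projection_apply_mem _ _, hEs, hEc, hEu, fun v => ?_⟩
  have hv : v ∈ Es ⊔ Ec ⊔ Eu := htop ▸ Submodule.mem_top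
  obtain ⟨_, h, w, hw, rfl⟩ := Submodule.mem_sup.1 hv
  obtain ⟨u, hu, z, hz, rfl⟩ := Submodule.mem_sup.1 h
  simp only [map_add, hEs u hu, hEc z hz, hEu w hw]
  abel

end Linear

section Base

variable {n : ℕ} {M : Type*} [TopologicalSpace M] [ChartedSpace (EuclideanSpace ℝ (Fin n)) M]

lemma Metric.derivMax_nonneg [IsManifold (𝓡 n) ∞ M] (g : Metric n M) (f : M → M) :
    0 ≤ g.derivMax f := by
  refine Real.sSup_nonneg ?_
  rintro _ ⟨x, v, -, rfl⟩
  exact g.len_nonneg _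

lemma Metric.len_zero [IsManifold (𝓡 n) ∞ M] (g : Metric n M) (x : M) :
    g.len (0 : TangentSpace (𝓡 n) x) = 0 := by
  simp [Metric.len]

lemma Metric.len_mfderiv_le [IsManifold (𝓡 n) ∞ M] [CompactSpace M] (g : Metric n M) {f : M → M}
    (hf : ContMDiff (𝓡 n) (𝓡 n) ∞ f) (x : M) (v : TangentSpace (𝓡 n) x) :
    g.len (mfderiv (𝓡 n) (𝓡 n) f x v) ≤ g.derivMax f * g.len v := by
  by_cases h0 : v = 0
  · rw [h0, map_zero, g.len_zero, g.len_zero, mul_zero]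
  obtain ⟨C, -, hC⟩ := exists_forall_le_mul (n := n) (M := M)
    (Q := fun z => g.len z.2) (R := fun z => g.len (mfderiv (𝓡 n) (𝓡 n) f z.1 z.2))
    g.continuous_len
    (g.continuous_len.comp (hf.continuous_tangentMap (by simp)))
    (fun x t v => g.len_smul t v)
    (fun x t v => by rw [map_smul]; exact g.len_smul t _) (fun x v hv => g.len_pos hv)
  have hbdd : BddAbove {r | ∃ (x : M) (v : TangentSpace (𝓡 n) x), g.len v = 1 ∧
    r = g.len (mfderiv (𝓡 n) (𝓡 n) f x v)} := by
    refine ⟨C, ?_⟩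
    rintro _ ⟨x, v, hv, rfl⟩
    simpa [hv] using hC x v
  have hl := g.len_pos h0
  have h1 : g.len (mfderiv (𝓡 n) (𝓡 n) f x ((g.len v)⁻¹ • v)) ≤ g.derivMax f :=
    le_csSup hbdd ⟨x, _, by
      rw [g.len_smul, abs_of_pos (inv_pos.2 hl), inv_mul_cancel₀ hl.ne'], rfl⟩
  rw [map_smul, g.len_smul, abs_of_pos (inv_pos.2 hl), inv_mul_le_iff₀ hl] at h1
  linarith

lemma Metric.le_len_mfderiv [IsManifold (𝓡 n) ∞ M] (g : Metric n M) {f : M → M}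
    (x : M) (v : TangentSpace (𝓡 n) x) :
    g.derivMin f * g.len v ≤ g.len (mfderiv (𝓡 n) (𝓡 n) f x v) := by
  by_cases h0 : v = 0
  · rw [h0, map_zero, g.len_zero, g.len_zero, mul_zero]
  have hbdd : BddBelow {r | ∃ (x : M) (v : TangentSpace (𝓡 n) x), g.len v = 1 ∧
    r = g.len (mfderiv (𝓡 n) (𝓡 n) f x v)} := by
    refine ⟨0, ?_⟩
    rintro _ ⟨x, v, hv, rfl⟩
    exact g.len_nonneg _
  have hl := g.len_pos h0
  have h1 : g.derivMin f ≤ g.len (mfderiv (𝓡 n) (𝓡 n) f x ((g.len v)⁻¹ • v)) :=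
    csInf_le hbdd ⟨x, _, by
      rw [g.len_smul, abs_of_pos (inv_pos.2 hl), inv_mul_cancel₀ hl.ne'], rfl⟩
  rw [map_smul, g.len_smul, abs_of_pos (inv_pos.2 hl), le_inv_mul_iff₀ hl] at h1
  linarith

lemma tangentMap_symm_tangentMap [IsManifold (𝓡 n) ∞ M] (f : M ≃ₘ^∞⟮𝓡 n, 𝓡 n⟯ M)
    (z : TangentBundle (𝓡 n) M) :
    tangentMap (𝓡 n) (𝓡 n) f.symm (tangentMap (𝓡 n) (𝓡 n) f z) = z := by
  have h := tangentMap_comp_at (I := 𝓡 n) (I' := 𝓡 n) (I'' := 𝓡 n) (f := f) (g := f.symm) z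
    (f.symm.contMDiff.mdifferentiableAt (by simp)) (f.contMDiff.mdifferentiableAt (by simp))
  rw [← h]
  have h2 : (f.symm ∘ f : M → M) = id := funext f.symm_apply_apply
  rw [h2, tangentMap_id]
  rfl

lemma tangentMap_tangentMap_symm [IsManifold (𝓡 n) ∞ M] (f : M ≃ₘ^∞⟮𝓡 n, 𝓡 n⟯ M)
    (z : TangentBundle (𝓡 n) M) :
    tangentMap (𝓡 n) (𝓡 n) f (tangentMap (𝓡 n) (𝓡 n) f.symm z) = z :=
  tangentMap_symm_tangentMap f.symm z

lemma Metric.len_mfderiv_symm_le [IsManifold (𝓡 n) ∞ M] (g : Metric n M)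
    (f : M ≃ₘ^∞⟮𝓡 n, 𝓡 n⟯ M) (h0 : 0 < g.derivMin f) (x : M) (v : TangentSpace (𝓡 n) x) :
    g.len (mfderiv (𝓡 n) (𝓡 n) f.symm x v) ≤ (g.derivMin f)⁻¹ * g.len v := by
  have h1 := g.le_len_mfderiv (f := f) (f.symm x) (mfderiv (𝓡 n) (𝓡 n) f.symm x v)
  have h2 := tangentMap_tangentMap_symm f ⟨x, v⟩
  have h3 : g.len (mfderiv (𝓡 n) (𝓡 n) f (f.symm x) (mfderiv (𝓡 n) (𝓡 n) f.symm x v)) =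
      g.len v := congrArg (fun z : TangentBundle (𝓡 n) M => g.len z.2) h2
  rw [h3] at h1
  rwa [le_inv_mul_iff₀ h0]

/-- A diffeomorphism of a closed manifold of positive dimension is neither uniformly contracting
nor uniformly expanding. -/
lemma Metric.one_le_derivMax [IsManifold (𝓡 n) ∞ M] [T2Space M] [CompactSpace M] [NeZero n]
    [Nonempty M] (g : Metric n M) (f : M ≃ₘ^∞⟮𝓡 n, 𝓡 n⟯ M) : 1 ≤ g.derivMax f := by
  by_contra! h
  exact not_contracting_of_surjective g f.contMDiff f.surjective (g.derivMax_nonneg f) h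
    fun x v => g.len_mfderiv_le f.contMDiff x v

lemma Metric.derivMin_le_one [IsManifold (𝓡 n) ∞ M] [T2Space M] [CompactSpace M] [NeZero n]
    [Nonempty M] (g : Metric n M) (f : M ≃ₘ^∞⟮𝓡 n, 𝓡 n⟯ M) : g.derivMin f ≤ 1 := by
  by_contra! h
  have h0 : 0 < g.derivMin f := zero_lt_one.trans h
  exact not_contracting_of_surjective g f.symm.contMDiff f.symm.surjective (inv_nonneg.2 h0.le)
    (inv_lt_one_of_one_lt₀ h) fun x v => g.len_mfderiv_symm_le f h0 x v

end Base

end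

/-! ### Invariant forms -/

section

variable {k d : ℕ} {E : Type*} [TopologicalSpace E] [ChartedSpace (EuclideanSpace ℝ (Fin d)) E]

/-- Not necessarily continuous one-forms on a manifold with values in `ℝᵏ`. -/
abbrev VecForm (k d : ℕ) (E : Type*) [TopologicalSpace E]
    [ChartedSpace (EuclideanSpace ℝ (Fin d)) E] : Type _ :=
  ∀ y : E, TangentSpace (𝓡 d) y →ₗ[ℝ] EuclideanSpace ℝ (Fin k)

/-- A one-form is continuous if it is continuous as a function on the tangent bundle. -/
def VecForm.IsCont [IsManifold (𝓡 d) ∞ E] (θ : VecForm k d E) : Prop :=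
  Continuous fun z : TangentBundle (𝓡 d) E => θ z.1 z.2

/-- The pullback `G^* θ` of a one-form, composed with a linear map of the values. -/
def VecForm.pull (B : EuclideanSpace ℝ (Fin k) →ₗ[ℝ] EuclideanSpace ℝ (Fin k)) (G : E → E)
    (θ : VecForm k d E) : VecForm k d E :=
  fun y => B ∘ₗ θ (G y) ∘ₗ (mfderiv (𝓡 d) (𝓡 d) G y).toLinearMap

lemma VecForm.pull_apply (B : EuclideanSpace ℝ (Fin k) →ₗ[ℝ] EuclideanSpace ℝ (Fin k)) (G : E → E)
    (θ : VecForm k d E) (y : E) (v : TangentSpace (𝓡 d) y) :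
    VecForm.pull B G θ y v = B (θ (G y) (mfderiv (𝓡 d) (𝓡 d) G y v)) := rfl

section

variable [IsManifold (𝓡 d) ∞ E]

lemma VecForm.IsCont.add {θ η : VecForm k d E} (hθ : θ.IsCont) (hη : η.IsCont) :
    VecForm.IsCont (θ + η) := Continuous.add hθ hη

lemma VecForm.IsCont.sub {θ η : VecForm k d E} (hθ : θ.IsCont) (hη : η.IsCont) :
    VecForm.IsCont (θ - η) := Continuous.sub hθ hη

lemma VecForm.IsCont.comp {θ : VecForm k d E} (hθ : θ.IsCont)
    (P : EuclideanSpace ℝ (Fin k) →ₗ[ℝ] EuclideanSpace ℝ (Fin k)) :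
    VecForm.IsCont fun y => P ∘ₗ θ y :=
  P.continuous_of_finiteDimensional.comp hθ

lemma VecForm.IsCont.pull {θ : VecForm k d E} (hθ : θ.IsCont)
    (B : EuclideanSpace ℝ (Fin k) →ₗ[ℝ] EuclideanSpace ℝ (Fin k)) {G : E → E}
    (hG : ContMDiff (𝓡 d) (𝓡 d) ∞ G) : VecForm.IsCont (VecForm.pull B G θ) :=
  B.continuous_of_finiteDimensional.comp
    (Continuous.comp (g := fun z : TangentBundle (𝓡 d) E => θ z.1 z.2) hθ
      (hG.continuous_tangentMap (by simp)))

/-- The twisted pullback `VecForm.pull B G`, where it contracts, has a fixed point near any form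
that it changes only by horizontal terms. Here `len` plays the role of the length of the horizontal
part of a vector; it grows at most by the factor `D`, while `B` contracts by the factor `σ`. The
fixed point is the sum of the form and the geometric series of the iterated pullbacks of the
change. -/
lemma VecForm.exists_fixed {θ : VecForm k d E} (hθ : θ.IsCont)
    {len : TangentBundle (𝓡 d) E → ℝ} (hlen : Continuous len)
    {G : E → E} (hG : ContMDiff (𝓡 d) (𝓡 d) ∞ G)
    {B : EuclideanSpace ℝ (Fin k) →ₗ[ℝ] EuclideanSpace ℝ (Fin k)}
    {S : Submodule ℝ (EuclideanSpace ℝ (Fin k))} (hθS : ∀ y v, θ y v ∈ S)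
    (hBS : ∀ v ∈ S, B v ∈ S) {σ D C : ℝ} (hσ : 0 ≤ σ) (hC : 0 ≤ C) (hD : 0 ≤ D) (hσD : σ * D < 1)
    (hB : ∀ v ∈ S, ‖B v‖ ≤ σ * ‖v‖)
    (hGlen : ∀ z, len (tangentMap (𝓡 d) (𝓡 d) G z) ≤ D * len z)
    (hchange : ∀ y v, ‖VecForm.pull B G θ y v - θ y v‖ ≤ C * len ⟨y, v⟩) :
    ∃ η : VecForm k d E, η.IsCont ∧ (∀ y v, η y v ∈ S) ∧
      (∀ y v, len ⟨y, v⟩ = 0 → η y v = θ y v) ∧ VecForm.pull B G η = η := by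
  let α : ℕ → VecForm k d E := fun j => (VecForm.pull B G)^[j] (VecForm.pull B G θ - θ)
  have hα0 : ∀ y v, α 0 y v = VecForm.pull B G θ y v - θ y v := fun y v => rfl
  have hαs : ∀ j y v, α (j + 1) y v = B (α j (G y) (mfderiv (𝓡 d) (𝓡 d) G y v)) := by
    intro j y v
    simp only [α, Function.iterate_succ_apply']
    rfl
  have hαc : ∀ j, (α j).IsCont := by
    intro j
    induction j with
    | zero => exact (hθ.pull B hG).sub hθ
    | succ j ih =>
      simp only [α, Function.iterate_succ_apply']
      exact VecForm.IsCont.pull ih B hG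
  have hαS : ∀ j y v, α j y v ∈ S := by
    intro j
    induction j with
    | zero => exact fun y v => S.sub_mem (hBS _ (hθS _ _)) (hθS _ _)
    | succ j ih => intro y v; rw [hαs]; exact hBS _ (ih _ _)
  have hαb : ∀ j y v, ‖α j y v‖ ≤ C * (σ * D) ^ j * len ⟨y, v⟩ := by
    intro j
    induction j with
    | zero => intro y v; rw [pow_zero, mul_one]; exact hchange y v
    | succ j ih =>
      intro y v
      rw [hαs]
      have h1 : len ⟨G y, mfderiv (𝓡 d) (𝓡 d) G y v⟩ ≤ D * len ⟨y, v⟩ := hGlen ⟨y, v⟩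
      calc _ ≤ σ * ‖α j (G y) (mfderiv (𝓡 d) (𝓡 d) G y v)‖ := hB _ (hαS _ _ _)
        _ ≤ σ * (C * (σ * D) ^ j * len ⟨G y, mfderiv (𝓡 d) (𝓡 d) G y v⟩) := by
          gcongr; exact ih _ _
        _ ≤ σ * (C * (σ * D) ^ j * (D * len ⟨y, v⟩)) := by gcongr
        _ = _ := by ring
  have hgeo : Summable fun j : ℕ => (σ * D) ^ j :=
    summable_geometric_of_lt_one (by positivity) hσD
  have hsum : ∀ y v, Summable fun j => α j y v := fun y v =>
    Summable.of_norm_bounded ((hgeo.mul_left C).mul_right (len ⟨y, v⟩)) fun j => hαb j y v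
  let β : VecForm k d E := fun y =>
    { toFun := fun v => ∑' j, α j y v
      map_add' := fun v w => by
        simp only [map_add]
        exact (hsum y v).tsum_add (hsum y w)
      map_smul' := fun c v => by
        simp only [map_smul, RingHom.id_apply]
        exact (hsum y v).tsum_const_smul c }
  have hβ : ∀ y v, β y v = ∑' j, α j y v := fun y v => rfl
  have hβc : β.IsCont := by
    refine continuous_iff_continuousAt.2 fun z => ?_
    have hU : {w | len w < len z + 1} ∈ 𝓝 z :=
      (isOpen_lt hlen continuous_const).mem_nhds (by simp)
    refine ContinuousOn.continuousAt (s := {w | len w < len z + 1}) ?_ hU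
    refine continuousOn_tsum (u := fun j => C * (σ * D) ^ j * (len z + 1))
      (fun j => (hαc j).continuousOn) ((hgeo.mul_left C).mul_right _) fun j w hw => ?_
    refine (hαb j w.1 w.2).trans ?_
    gcongr
    exact le_of_lt hw
  refine ⟨θ + β, hθ.add hβc, fun y v => S.add_mem (hθS y v) ?_, fun y v h => ?_, ?_⟩
  · rw [hβ]
    exact S.closed_of_finiteDimensional.mem_of_tendsto (hsum y v).hasSum
      (Filter.Eventually.of_forall fun s => S.sum_mem fun j _ => hαS j y v)
  · have h0 : ∀ j, α j y v = 0 := fun j => by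
      have := hαb j y v
      rw [h, mul_zero] at this
      exact norm_le_zero_iff.1 this
    change θ y v + β y v = θ y v
    rw [hβ]
    simp [h0]
  · funext y
    ext1 v
    rw [VecForm.pull_apply]
    change B (θ _ _ + β _ _) = θ y v + β y v
    have h1 : B (β (G y) (mfderiv (𝓡 d) (𝓡 d) G y v)) = ∑' j, α (j + 1) y v := by
      simp only [hβ, hαs]
      exact (LinearMap.toContinuousLinearMap B).map_tsum (hsum _ _)
    rw [map_add, h1, hβ y v, (hsum y v).tsum_eq_zero_add, hα0, VecForm.pull_apply]
    abel

end

end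

/-! ### Connection forms and the metrics built from them -/

section

section Real

lemma sqrt_add_sq_le {x y z δ : ℝ} (hx : 0 ≤ x) (hy : 0 ≤ y) (hδ : 0 ≤ δ) (h : x ≤ y + δ) :
    √(x ^ 2 + z ^ 2) ≤ √(y ^ 2 + z ^ 2) + δ := by
  rw [Real.sqrt_le_left (by positivity)]
  have h1 := Real.sq_sqrt (show 0 ≤ y ^ 2 + z ^ 2 by positivity)
  have h2 : y ≤ √(y ^ 2 + z ^ 2) := Real.le_sqrt_of_sq_le (by nlinarith [sq_nonneg z])
  nlinarith

/-- Growth estimates for the norm `√(t² + (K h)²)`, where `t` and `h` are the sizes of the vertical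
and the horizontal component of a vector. Up to an error of size at most `ε`, the vertical size is
`a` before and `a'` after the map, and both `a` and `h` grow by a factor in `[m, M]`. -/
lemma sqrt_growth {t t' a a' h h' K ε m M : ℝ} (ht : 0 ≤ t) (ht' : 0 ≤ t') (ha : 0 ≤ a)
    (ha' : 0 ≤ a') (hh : 0 ≤ h) (hh' : 0 ≤ h') (hK : 0 < K) (hε : 0 ≤ ε) (hm : 0 ≤ m) (hM : 0 ≤ M)
    (h1 : |t - a| ≤ ε) (h2 : |t' - a'| ≤ ε) (h3 : m * a ≤ a') (h4 : a' ≤ M * a)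
    (h5 : m * h ≤ h') (h6 : h' ≤ M * h) (hone : √(t ^ 2 + (K * h) ^ 2) = 1) :
    m * (1 - ε) - ε ≤ √(t' ^ 2 + (K * h') ^ 2) ∧ √(t' ^ 2 + (K * h') ^ 2) ≤ M * (1 + ε) + ε := by
  rw [abs_le] at h1 h2
  have hscale : ∀ c : ℝ, 0 ≤ c →
      √((c * a) ^ 2 + (K * (c * h)) ^ 2) = c * √(a ^ 2 + (K * h) ^ 2) := by
    intro c hc
    rw [show (c * a) ^ 2 + (K * (c * h)) ^ 2 = c ^ 2 * (a ^ 2 + (K * h) ^ 2) by ring,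
      Real.sqrt_mul (sq_nonneg c), Real.sqrt_sq hc]
  have e1 : √(t ^ 2 + (K * h) ^ 2) ≤ √(a ^ 2 + (K * h) ^ 2) + ε :=
    sqrt_add_sq_le ht ha hε (by linarith)
  have e2 : √(a ^ 2 + (K * h) ^ 2) ≤ √(t ^ 2 + (K * h) ^ 2) + ε :=
    sqrt_add_sq_le ha ht hε (by linarith)
  have e3 : √(t' ^ 2 + (K * h') ^ 2) ≤ √(a' ^ 2 + (K * h') ^ 2) + ε :=
    sqrt_add_sq_le ht' ha' hε (by linarith)
  have e4 : √(a' ^ 2 + (K * h') ^ 2) ≤ √(t' ^ 2 + (K * h') ^ 2) + ε :=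
    sqrt_add_sq_le ha' ht' hε (by linarith)
  have e5 : m * √(a ^ 2 + (K * h) ^ 2) ≤ √(a' ^ 2 + (K * h') ^ 2) := by
    rw [← hscale m hm]
    gcongr
  have e6 : √(a' ^ 2 + (K * h') ^ 2) ≤ M * √(a ^ 2 + (K * h) ^ 2) := by
    rw [← hscale M hM]
    gcongr
  rw [hone] at e1 e2
  constructor
  · nlinarith [mul_le_mul_of_nonneg_left e1 hm]
  · nlinarith [mul_le_mul_of_nonneg_left e2 hM]

end Real

variable {k b d : ℕ} {X : Type*} {E : Type*}
  [TopologicalSpace X] [ChartedSpace (EuclideanSpace ℝ (Fin b)) X] [IsManifold (𝓡 b) ∞ X]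
  [TopologicalSpace E] [ChartedSpace (EuclideanSpace ℝ (Fin d)) E] [IsManifold (𝓡 d) ∞ E]
  [MulAction (Torus k) E] {p : E → X}

/-- The length of the projection of a tangent vector to the base. -/
def horLen (g : Metric b X) (p : E → X) (z : TangentBundle (𝓡 d) E) : ℝ :=
  g.len (mfderiv (𝓡 d) (𝓡 b) p z.1 z.2)

omit [IsManifold (𝓡 d) ∞ E] in
lemma horLen_nonneg (g : Metric b X) (z : TangentBundle (𝓡 d) E) : 0 ≤ horLen g p z :=
  g.len_nonneg _

lemma continuous_horLen (g : Metric b X) (hp : ContMDiff (𝓡 d) (𝓡 b) ∞ p) :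
    Continuous (horLen (d := d) g p) :=
  g.continuous_len.comp (hp.continuous_tangentMap (by simp))

omit [IsManifold (𝓡 d) ∞ E] in
lemma horLen_smul (g : Metric b X) (y : E) (t : ℝ) (v : TangentSpace (𝓡 d) y) :
    horLen g p ⟨y, t • v⟩ = |t| * horLen g p ⟨y, v⟩ := by
  simp only [horLen, map_smul]
  exact g.len_smul t _

omit [IsManifold (𝓡 d) ∞ E] in
lemma horLen_eq_zero (g : Metric b X) {y : E} {v : TangentSpace (𝓡 d) y} :
    horLen g p ⟨y, v⟩ = 0 ↔ mfderiv (𝓡 d) (𝓡 b) p y v = 0 := by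
  refine ⟨fun h => ?_, fun h => ?_⟩
  · by_contra h0
    exact (g.len_pos h0).ne' h
  · simp only [horLen]
    rw [h]
    exact g.len_zero _

/-- A form on the total space of a principal torus bundle restricts to the identity on the
fibers. Unlike for a principal connection, invariance under the torus is not required. -/
def IsConnection (θ : VecForm k d E) : Prop := ∀ y a, θ y (orbitDeriv k y a) = a

section Bundle

variable (hp : IsPrincipalTorusBundle (k := k) (b := b) (d := d) p)
include hp

omit [IsManifold (𝓡 b) ∞ X] [IsManifold (𝓡 d) ∞ E] in
lemma exists_orbitDeriv_eq (hd : d = b + k) {y : E} {v : TangentSpace (𝓡 d) y}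
    (h : mfderiv (𝓡 d) (𝓡 b) p y v = 0) : ∃ a, orbitDeriv k y a = v := by
  have h1 : v ∈ vertical b d p y := h
  rw [← hp.range_orbitDeriv hd y] at h1
  exact h1

/-- A form that vanishes on the fibers is bounded by the length of the projection to the base. -/
lemma exists_le_horLen [CompactSpace E] (hd : d = b + k) (g : Metric b X) {θ η : VecForm k d E}
    (hθ : θ.IsCont) (hθ1 : IsConnection θ) (hη : η.IsCont)
    (hη0 : ∀ y a, η y (orbitDeriv k y a) = 0) :
    ∃ C : ℝ, 0 ≤ C ∧ ∀ y v, ‖η y v‖ ≤ C * horLen g p ⟨y, v⟩ := by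
  obtain ⟨C, hC0, hC⟩ := exists_forall_le_mul (n := d) (M := E)
    (Q := fun z => ‖θ z.1 z.2‖ + horLen g p z) (R := fun z => ‖η z.1 z.2‖)
    ((Continuous.norm hθ).add (continuous_horLen g hp.contMDiff_proj)) (Continuous.norm hη)
    (fun x t v => by
      rw [horLen_smul, map_smul, norm_smul, Real.norm_eq_abs, mul_add])
    (fun x t v => by rw [map_smul, norm_smul, Real.norm_eq_abs])
    (fun x v hv => by
      refine lt_of_le_of_ne (add_nonneg (norm_nonneg _) (horLen_nonneg g _)) fun h0 => hv ?_
      have h1 := (add_eq_zero_iff_of_nonneg (norm_nonneg (θ x v)) (horLen_nonneg g _)).1 h0.symm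
      obtain ⟨a, rfl⟩ := exists_orbitDeriv_eq hp hd ((horLen_eq_zero g).1 h1.2)
      rw [hθ1, norm_eq_zero] at h1
      rw [h1.1, map_zero])
  refine ⟨C, hC0, fun y v => ?_⟩
  have h1 := hC y (v - orbitDeriv k y (θ y v))
  simp only [map_sub, hη0, sub_zero, hθ1 y, sub_self, norm_zero, zero_add] at h1
  refine h1.trans (le_of_eq ?_)
  simp only [horLen, map_sub]
  rw [hp.mfderiv_orbitDeriv]
  simp

/-- Combining a smooth connection form with a metric on the base, scaled by a factor `K`, gives a
metric on the total space. -/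
lemma exists_metric_of_connection (hd : d = b + k) (g : Metric b X) {θ : VecForm k d E}
    (hθ : ContMDiff (𝓡 d).tangent (𝓡 k) ∞ (fun z : TangentBundle (𝓡 d) E => θ z.1 z.2))
    (hθ1 : IsConnection θ) {K : ℝ} (hK : 0 < K) :
    ∃ G : Metric d E, ∀ y (v : TangentSpace (𝓡 d) y),
      G.len v = √(‖θ y v‖ ^ 2 + (K * horLen g p ⟨y, v⟩) ^ 2) := by
  let B : ∀ y : E, TangentSpace (𝓡 d) y →ₗ[ℝ] TangentSpace (𝓡 d) y →ₗ[ℝ] ℝ := fun y =>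
    LinearMap.mk₂ ℝ (fun v w => inner ℝ (θ y v) (θ y w) +
      K ^ 2 * g.inner (p y) (mfderiv (𝓡 d) (𝓡 b) p y v) (mfderiv (𝓡 d) (𝓡 b) p y w))
      (fun v v' w => by simp only [map_add, inner_add_left, add_apply]; ring)
      (fun c v w => by
        simp only [map_smul, inner_smul_left, smul_apply, smul_eq_mul]; simp; ring)
      (fun v w w' => by simp only [map_add, inner_add_right]; ring)
      (fun c v w => by
        simp only [map_smul, inner_smul_right, smul_eq_mul]; ring)
  have hB : ∀ y v w, B y v w = inner ℝ (θ y v) (θ y w) +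
      K ^ 2 * g.inner (p y) (mfderiv (𝓡 d) (𝓡 b) p y v) (mfderiv (𝓡 d) (𝓡 b) p y w) :=
    fun y v w => rfl
  have hBv : ∀ y v, B y v v = ‖θ y v‖ ^ 2 + (K * horLen g p ⟨y, v⟩) ^ 2 := by
    intro y v
    rw [hB, real_inner_self_eq_norm_sq, mul_pow]
    congr 2
    exact (g.len_sq _).symm
  obtain ⟨G, hG⟩ := exists_metric_of_bilin B
    (fun y v w => by rw [hB, hB, real_inner_comm, g.symm])
    (fun y v hv => by
      rw [hBv]
      by_cases h : horLen g p ⟨y, v⟩ = 0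
      · obtain ⟨a, rfl⟩ := exists_orbitDeriv_eq hp hd ((horLen_eq_zero g).1 h)
        have ha : a ≠ 0 := by
          rintro rfl
          exact hv (map_zero _)
        rw [hθ1]
        positivity
      · have h1 := lt_of_le_of_ne (horLen_nonneg g _) (Ne.symm h)
        positivity)
    (fun x₀ v w => by
      have hf := contMDiffOn_tangentFrame (n := d) (M := E) x₀
      intro x hx
      have hU : frameSet d x₀ ∈ 𝓝 x := (trivializationAt (EuclideanSpace ℝ (Fin d))
        (TangentSpace (𝓡 d) : E → Type _) x₀).open_baseSet.mem_nhds hx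
      refine ContMDiffAt.contMDiffWithinAt ?_
      have hv := (hf v).contMDiffAt hU
      have hw := (hf w).contMDiffAt hU
      have hθv : ContMDiffAt (𝓡 d) (𝓡 k) ∞ (fun y => θ y (tangentFrame x₀ y v)) x :=
        ContMDiffAt.comp x (hθ _) hv
      have hθw : ContMDiffAt (𝓡 d) (𝓡 k) ∞ (fun y => θ y (tangentFrame x₀ y w)) x :=
        ContMDiffAt.comp x (hθ _) hw
      have hT := hp.contMDiff_proj.contMDiff_tangentMap (m := ∞) (by rfl)
      have h1 : ContMDiffAt (𝓡 d) 𝓘(ℝ, ℝ) ∞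
          (fun y => inner ℝ (θ y (tangentFrame x₀ y v)) (θ y (tangentFrame x₀ y w))) x := by
        have h2 : ContDiff ℝ ∞ fun q : EuclideanSpace ℝ (Fin k) × EuclideanSpace ℝ (Fin k) =>
          inner ℝ q.1 q.2 := contDiff_fst.inner ℝ contDiff_snd
        exact h2.contMDiff.contMDiffAt.comp x (hθv.prodMk_space hθw)
      have h3 : ContMDiffAt (𝓡 d) 𝓘(ℝ, ℝ) ∞ (fun y => g.inner (p y)
          (mfderiv (𝓡 d) (𝓡 b) p y (tangentFrame x₀ y v))
          (mfderiv (𝓡 d) (𝓡 b) p y (tangentFrame x₀ y w))) x :=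
        g.contMDiffAt_inner (ContMDiffAt.comp x (hT _) hv) (ContMDiffAt.comp x (hT _) hw)
      exact h1.add (contMDiffAt_const.mul h3))
  refine ⟨G, fun y v => ?_⟩
  rw [Metric.len, hG, hBv]

omit [IsManifold (𝓡 b) ∞ X] in
lemma continuousOn_orbitDeriv {θ : VecForm k d E} (hθ : θ.IsCont) (z : E)
    (v : EuclideanSpace ℝ (Fin d)) :
    ContinuousOn (fun x => (⟨x, orbitDeriv k x (θ x (tangentFrame z x v))⟩ :
      TangentBundle (𝓡 d) E)) (frameSet d z) := by
  have h1 : ContinuousOn (fun x => θ x (tangentFrame z x v)) (frameSet d z) :=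
    Continuous.comp_continuousOn (g := fun z : TangentBundle (𝓡 d) E => θ z.1 z.2) hθ
      (contMDiffOn_tangentFrame z v).continuousOn
  exact (contMDiff_orbitDeriv hp.contMDiff_smul).continuous.comp_continuousOn
    (continuousOn_id.prodMk h1)

omit [IsManifold (𝓡 b) ∞ X] in
/-- The subspaces of the fiber directions induced by a subspace of `ℝᵏ` form a subbundle. -/
lemma isSubbundle_fiberwise {θ : VecForm k d E} (hθ : θ.IsCont) (hθ1 : IsConnection θ)
    {V : Submodule ℝ (EuclideanSpace ℝ (Fin k))}
    {P : EuclideanSpace ℝ (Fin k) →ₗ[ℝ] EuclideanSpace ℝ (Fin k)} (hP : ∀ v, P v ∈ V)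
    (hPV : ∀ v ∈ V, P v = v) : IsSubbundle (fiberwise d (E := E) V) := by
  refine isSubbundle_range_of_projection (r := Module.finrank ℝ V)
    (fun y => orbitDeriv k y ∘ₗ P ∘ₗ θ y) (fun z v => continuousOn_orbitDeriv hp (hθ.comp P) z v)
    (fun y v => ⟨_, hP _, rfl⟩) ?_ fun y => ?_
  · rintro y _ ⟨a, ha, rfl⟩
    change orbitDeriv k y (P (θ y (orbitDeriv k y a))) = _
    rw [hθ1, hPV a ha]
  · exact (Submodule.equivMapOfInjective _ (hp.orbitDeriv_injective y) V).finrank_eq.symm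

omit [IsManifold (𝓡 b) ∞ X] in
/-- If a continuous form with values in `R` restricts to the identity on the directions in `R`
along the fibers, then its kernel is a subbundle. -/
lemma isSubbundle_ker {η : VecForm k d E} (hη : η.IsCont)
    {R : Submodule ℝ (EuclideanSpace ℝ (Fin k))} (hηR : ∀ y v, η y v ∈ R)
    (hη1 : ∀ y, ∀ a ∈ R, η y (orbitDeriv k y a) = a) :
    IsSubbundle fun y : E => LinearMap.ker (η y) := by
  refine isSubbundle_range_of_projection (r := d - Module.finrank ℝ R)
    (fun y => LinearMap.id - orbitDeriv k y ∘ₗ η y) (fun z v => ?_) (fun y v => ?_)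
    (fun y v hv => ?_) fun y => ?_
  · have h1 : ContMDiffOn (𝓡 d) (𝓡 d).tangent 0 (fun x => (⟨x, orbitDeriv k x
        (η x (tangentFrame z x v))⟩ : TangentBundle (𝓡 d) E)) (frameSet d z) :=
      contMDiffOn_zero_iff.2 (continuousOn_orbitDeriv hp hη z v)
    have h2 : ContMDiffOn (𝓡 d) (𝓡 d).tangent 0 (fun x => (⟨x, tangentFrame z x v⟩ :
        TangentBundle (𝓡 d) E)) (frameSet d z) :=
      contMDiffOn_zero_iff.2 (contMDiffOn_tangentFrame (n := d) (M := E) z v).continuousOn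
    exact (ContMDiffOn.sub_section h2 h1).continuousOn
  · change η y (v - orbitDeriv k y (η y v)) = 0
    rw [map_sub, hη1 y _ (hηR y v), sub_self]
  · change v - orbitDeriv k y (η y v) = v
    rw [LinearMap.mem_ker.1 hv, map_zero, sub_zero]
  · have hfd : FiniteDimensional ℝ (TangentSpace (𝓡 d) y) :=
      inferInstanceAs (FiniteDimensional ℝ (EuclideanSpace ℝ (Fin d)))
    have hrd : Module.finrank ℝ (TangentSpace (𝓡 d) y) = d :=
      finrank_euclideanSpace_fin (𝕜 := ℝ) (n := d)
    have h1 := (η y).finrank_range_add_finrank_ker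
    have h2 : LinearMap.range (η y) = R := le_antisymm
      (by rintro _ ⟨v, rfl⟩; exact hηR y v) fun a ha => ⟨_, hη1 y a ha⟩
    rw [h2, hrd] at h1
    omega

end Bundle

end

/-! ### Invariant forms and growth estimates on the total space -/

section

variable {k b d : ℕ} {X : Type*} {E : Type*}
  [TopologicalSpace X] [ChartedSpace (EuclideanSpace ℝ (Fin b)) X] [IsManifold (𝓡 b) ∞ X]
  [TopologicalSpace E] [ChartedSpace (EuclideanSpace ℝ (Fin d)) E] [IsManifold (𝓡 d) ∞ E]
  [MulAction (Torus k) E] {p : E → X} {A : Matrix.SpecialLinearGroup (Fin k) ℤ}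
  {f : X ≃ₘ^∞⟮𝓡 b, 𝓡 b⟯ X}

omit [IsManifold (𝓡 b) ∞ X] in
/-- An `A`-map over a diffeomorphism is a diffeomorphism. -/
lemma IsAMap.exists_diffeomorph (hp : IsPrincipalTorusBundle (k := k) (b := b) (d := d) p)
    (hd : d = b + k) {F : E → E} (hF : IsAMap (d := d) A p f F) :
    ∃ Φ : E ≃ₘ^∞⟮𝓡 d, 𝓡 d⟯ E, ∀ y, Φ y = F y := by
  refine exists_diffeomorph_of_bijective hF.contMDiff (hF.bijective hp f.bijective) fun y => ?_
  refine (injective_iff_map_eq_zero _).2 fun v hv => ?_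
  have h1 := hF.mfderiv_covers hp f.contMDiff y v
  rw [hv, map_zero] at h1
  have h2 : mfderiv (𝓡 d) (𝓡 b) p y v = 0 :=
    (injective_iff_map_eq_zero (f.mfderivToContinuousLinearEquiv (by simp) (p y))).1
      (f.mfderivToContinuousLinearEquiv (by simp) (p y)).injective _ h1.symm
  obtain ⟨a, rfl⟩ := exists_orbitDeriv_eq hp hd h2
  rw [hF.mfderiv_orbitDeriv hp] at hv
  have h3 := (injective_iff_map_eq_zero _).1 (hp.orbitDeriv_injective (F y)) _ hv
  rw [← realLin_inv_apply A a, h3, map_zero, map_zero]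

/-- Tangent vectors at equal points with the same coordinate vector have the same length. -/
lemma Metric.len_congr (g : Metric b X) {x x' : X} (h : x = x') {v : TangentSpace (𝓡 b) x}
    {w : TangentSpace (𝓡 b) x'} (hv : (id v : EuclideanSpace ℝ (Fin b)) = w) :
    g.len v = g.len w := by
  subst h
  exact congrArg g.len hv

section

variable (hp : IsPrincipalTorusBundle (k := k) (b := b) (d := d) p)
  {Φ : E ≃ₘ^∞⟮𝓡 d, 𝓡 d⟯ E} (hΦ : IsAMap (d := d) A p f Φ) (g : Metric b X)
include hp hΦ

omit [IsManifold (𝓡 d) ∞ E] in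
lemma horLen_tangentMap (z : TangentBundle (𝓡 d) E) :
    horLen g p (tangentMap (𝓡 d) (𝓡 d) Φ z) =
      g.len (mfderiv (𝓡 b) (𝓡 b) f (p z.1) (mfderiv (𝓡 d) (𝓡 b) p z.1 z.2)) :=
  g.len_congr (hΦ.covers z.1) (hΦ.mfderiv_covers hp f.contMDiff z.1 z.2)

omit [IsManifold (𝓡 d) ∞ E] in
lemma horLen_tangentMap_le [CompactSpace X] (z : TangentBundle (𝓡 d) E) :
    horLen g p (tangentMap (𝓡 d) (𝓡 d) Φ z) ≤ g.derivMax f * horLen g p z := by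
  rw [horLen_tangentMap hp hΦ]
  exact g.len_mfderiv_le f.contMDiff _ _

omit [IsManifold (𝓡 d) ∞ E] in
lemma le_horLen_tangentMap (z : TangentBundle (𝓡 d) E) :
    g.derivMin f * horLen g p z ≤ horLen g p (tangentMap (𝓡 d) (𝓡 d) Φ z) := by
  rw [horLen_tangentMap hp hΦ]
  exact g.le_len_mfderiv _ _

lemma horLen_tangentMap_symm_le (h0 : 0 < g.derivMin f) (z : TangentBundle (𝓡 d) E) :
    horLen g p (tangentMap (𝓡 d) (𝓡 d) Φ.symm z) ≤ (g.derivMin f)⁻¹ * horLen g p z := by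
  have h1 := le_horLen_tangentMap hp hΦ g (tangentMap (𝓡 d) (𝓡 d) Φ.symm z)
  rw [tangentMap_tangentMap_symm] at h1
  rwa [le_inv_mul_iff₀ h0]

omit [IsManifold (𝓡 b) ∞ X] in
lemma mfderiv_symm_orbitDeriv (y : E) (a : EuclideanSpace ℝ (Fin k)) :
    mfderiv (𝓡 d) (𝓡 d) Φ.symm y (orbitDeriv k y a) = orbitDeriv k (Φ.symm y) (realLin A⁻¹ a) := by
  obtain ⟨x, rfl⟩ := Φ.surjective y
  have h1 := tangentMap_symm_tangentMap Φ ⟨x, orbitDeriv k x (realLin A⁻¹ a)⟩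
  have h2 : tangentMap (𝓡 d) (𝓡 d) Φ ⟨x, orbitDeriv k x (realLin A⁻¹ a)⟩ =
      ⟨Φ x, orbitDeriv k (Φ x) a⟩ := by
    refine congrArg (TotalSpace.mk (Φ x)) ?_
    rw [hΦ.mfderiv_orbitDeriv hp, realLin_apply_inv]
  rw [h2] at h1
  have h3 : ∀ z : TangentBundle (𝓡 d) E, z = ⟨x, orbitDeriv k x (realLin A⁻¹ a)⟩ →
      z = ⟨Φ.symm (Φ x), orbitDeriv k (Φ.symm (Φ x)) (realLin A⁻¹ a)⟩ := by
    rw [Φ.symm_apply_apply]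
    exact fun _ h => h
  exact eq_of_heq (TotalSpace.mk.inj (h3 _ h1)).2

variable {g} [CompactSpace E] (hd : d = b + k) {θ : VecForm k d E} (hθ : θ.IsCont)
  (hθ1 : IsConnection θ) {V : Submodule ℝ (EuclideanSpace ℝ (Fin k))}
  (hV : V.map (realLin A) = V) {P : EuclideanSpace ℝ (Fin k) →ₗ[ℝ] EuclideanSpace ℝ (Fin k)}
  (hP : ∀ v, P v ∈ V) (hPA : ∀ v, P (realLin A v) = realLin A (P v))
include hd hθ hθ1 hV hP hPA

/-- A projection onto a subspace of `ℝᵏ` that `A` contracts more strongly than `f` contracts `X`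
extends from the fibers to an equivariant continuous form on the total space. -/
lemma exists_stable_form (hdom : linMax A V < g.derivMin f) :
    ∃ η : VecForm k d E, η.IsCont ∧ (∀ y v, η y v ∈ V) ∧
      (∀ y a, η y (orbitDeriv k y a) = P a) ∧
      ∀ y v, η (Φ y) (mfderiv (𝓡 d) (𝓡 d) Φ y v) = realLin A (η y v) := by
  have h0 : 0 < g.derivMin f := (linMax_nonneg A V).trans_lt hdom
  have hθP := hθ.comp P
  obtain ⟨C, hC0, hC⟩ := exists_le_horLen hp hd g hθ hθ1
    ((hθP.pull (realLin A) Φ.symm.contMDiff).sub hθP) (fun y a => by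
      change realLin A (P (θ _ (mfderiv (𝓡 d) (𝓡 d) Φ.symm y (orbitDeriv k y a)))) -
        P (θ y (orbitDeriv k y a)) = 0
      rw [mfderiv_symm_orbitDeriv hp hΦ, hθ1, hθ1, ← hPA, realLin_apply_inv, sub_self])
  obtain ⟨η, hηc, hηV, hη0, hηf⟩ := VecForm.exists_fixed hθP
    (continuous_horLen g hp.contMDiff_proj) Φ.symm.contMDiff (S := V)
    (fun y v => hP _) (fun v hv => by rw [← hV]; exact Submodule.mem_map_of_mem hv)
    (linMax_nonneg A V) hC0 (inv_nonneg.2 h0.le)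
    (by rwa [← div_eq_mul_inv, div_lt_one h0]) (fun v hv => norm_realLin_le_linMax A hv)
    (horLen_tangentMap_symm_le hp hΦ g h0) hC
  refine ⟨η, hηc, hηV, fun y a => ?_, fun y v => ?_⟩
  · rw [hη0 y _ ((horLen_eq_zero g).2 (hp.mfderiv_orbitDeriv y a))]
    change P (θ y _) = _
    rw [hθ1]
  · have h1 : η (Φ y) (mfderiv (𝓡 d) (𝓡 d) Φ y v) =
        VecForm.pull (realLin A) Φ.symm η (Φ y) (mfderiv (𝓡 d) (𝓡 d) Φ y v) := by rw [hηf]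
    rw [h1, VecForm.pull_apply]
    exact congrArg (fun z : TangentBundle (𝓡 d) E => realLin A (η z.1 z.2))
      (tangentMap_symm_tangentMap Φ ⟨y, v⟩)

/-- A projection onto a subspace of `ℝᵏ` that `A` expands more strongly than `f` expands `X`
extends from the fibers to an equivariant continuous form on the total space. -/
lemma exists_unstable_form [CompactSpace X] (hdom : g.derivMax f < linMin A V) :
    ∃ η : VecForm k d E, η.IsCont ∧ (∀ y v, η y v ∈ V) ∧
      (∀ y a, η y (orbitDeriv k y a) = P a) ∧
      ∀ y v, η (Φ y) (mfderiv (𝓡 d) (𝓡 d) Φ y v) = realLin A (η y v) := by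
  have h0 : 0 < linMin A V := (g.derivMax_nonneg f).trans_lt hdom
  have hθP := hθ.comp P
  obtain ⟨C, hC0, hC⟩ := exists_le_horLen hp hd g hθ hθ1
    ((hθP.pull (realLin A⁻¹) Φ.contMDiff).sub hθP) (fun y a => by
      change realLin A⁻¹ (P (θ _ (mfderiv (𝓡 d) (𝓡 d) Φ y (orbitDeriv k y a)))) -
        P (θ y (orbitDeriv k y a)) = 0
      rw [hΦ.mfderiv_orbitDeriv hp, hθ1, hθ1, hPA, realLin_inv_apply, sub_self])
  obtain ⟨η, hηc, hηV, hη0, hηf⟩ := VecForm.exists_fixed hθP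
    (continuous_horLen g hp.contMDiff_proj) Φ.contMDiff (S := V)
    (fun y v => hP _) (fun v hv => realLin_inv_mem A hV hv)
    (inv_nonneg.2 h0.le) hC0 (g.derivMax_nonneg f)
    (by rwa [inv_mul_lt_one₀ h0]) (fun v hv => by
      have h1 := linMin_le_norm_realLin A (realLin_inv_mem A hV hv)
      rw [realLin_apply_inv] at h1
      rwa [le_inv_mul_iff₀ h0])
    (horLen_tangentMap_le hp hΦ g) hC
  refine ⟨η, hηc, hηV, fun y a => ?_, fun y v => ?_⟩
  · rw [hη0 y _ ((horLen_eq_zero g).2 (hp.mfderiv_orbitDeriv y a))]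
    change P (θ y _) = _
    rw [hθ1]
  · conv_rhs => rw [← hηf, VecForm.pull_apply, realLin_apply_inv]

end

/-- If `β` is an equivariant form that extends a projection `P` commuting with `A`, then the growth
of vectors in the kernel of `β` is controlled, in a suitable metric, by the growth under `f` and the
growth under `A` in the range of the complementary projection. The metric scales up the horizontal
directions so much that the failure of the connection `θ` to be equivariant is negligible. -/
lemma exists_metric_center [CompactSpace X] [CompactSpace E]
    (hp : IsPrincipalTorusBundle (k := k) (b := b) (d := d) p) (hd : d = b + k)
    {Φ : E ≃ₘ^∞⟮𝓡 d, 𝓡 d⟯ E} (hΦ : IsAMap (d := d) A p f Φ) (g : Metric b X) {θ : VecForm k d E}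
    (hθ : ContMDiff (𝓡 d).tangent (𝓡 k) ∞ (fun z : TangentBundle (𝓡 d) E => θ z.1 z.2))
    (hθ1 : IsConnection θ) {β : VecForm k d E} (hβ : β.IsCont)
    {P Q : EuclideanSpace ℝ (Fin k) →ₗ[ℝ] EuclideanSpace ℝ (Fin k)} (hPQ : ∀ v, P v + Q v = v)
    (hQA : ∀ v, Q (realLin A v) = realLin A (Q v))
    (hβ1 : ∀ y a, β y (orbitDeriv k y a) = P a)
    (hβA : ∀ y v, β (Φ y) (mfderiv (𝓡 d) (𝓡 d) Φ y v) = realLin A (β y v)) {m M ε : ℝ}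
    (hm : 0 ≤ m) (hmf : m ≤ g.derivMin f) (hMf : g.derivMax f ≤ M)
    (hmA : ∀ v, m * ‖Q v‖ ≤ ‖realLin A (Q v)‖) (hMA : ∀ v, ‖realLin A (Q v)‖ ≤ M * ‖Q v‖)
    (hε : 0 < ε) :
    ∃ G : Metric d E, (∀ y a, G.len (orbitDeriv k y a : TangentSpace (𝓡 d) y) = ‖a‖) ∧
      ∀ y v, β y v = 0 → G.len v = 1 →
        m * (1 - ε) - ε ≤ G.len (mfderiv (𝓡 d) (𝓡 d) Φ y v) ∧
        G.len (mfderiv (𝓡 d) (𝓡 d) Φ y v) ≤ M * (1 + ε) + ε := by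
  have hM : 0 ≤ M := (g.derivMax_nonneg f).trans hMf
  have hθc : θ.IsCont := hθ.continuous
  obtain ⟨C₁, hC₁, h₁⟩ := exists_le_horLen hp hd g hθc hθ1 ((hθc.comp P).sub hβ) (fun y a => by
    change P (θ y (orbitDeriv k y a)) - β y (orbitDeriv k y a) = 0
    rw [hθ1, hβ1, sub_self])
  obtain ⟨C₂, hC₂, h₂⟩ := exists_le_horLen hp hd g hθc hθ1
    (((hθc.comp Q).pull LinearMap.id Φ.contMDiff).sub ((hθc.comp Q).comp (realLin A)))
    (fun y a => by
      change Q (θ _ (mfderiv (𝓡 d) (𝓡 d) Φ y (orbitDeriv k y a))) -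
        realLin A (Q (θ y (orbitDeriv k y a))) = 0
      rw [hΦ.mfderiv_orbitDeriv hp, hθ1, hθ1, hQA, sub_self])
  -- `C` bounds the errors before and after an application of `Φ` in terms of `horLen`
  let C := C₁ + C₁ * M + C₂
  have hC : 0 ≤ C := by positivity
  have hK : 0 < (C + 1) / ε := by positivity
  obtain ⟨G, hG⟩ := exists_metric_of_connection hp hd g hθ hθ1 hK
  refine ⟨G, fun y a => ?_, fun y v hv h1 => ?_⟩
  · rw [hG, hθ1, (horLen_eq_zero g).2 (hp.mfderiv_orbitDeriv y a)]
    simp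
  have hh := horLen_nonneg (p := p) g ⟨y, v⟩
  have hup : horLen g p ⟨Φ y, mfderiv (𝓡 d) (𝓡 d) Φ y v⟩ ≤ M * horLen g p ⟨y, v⟩ :=
    (horLen_tangentMap_le hp hΦ g ⟨y, v⟩).trans (by gcongr)
  have hlow : m * horLen g p ⟨y, v⟩ ≤ horLen g p ⟨Φ y, mfderiv (𝓡 d) (𝓡 d) Φ y v⟩ :=
    le_trans (by gcongr) (le_horLen_tangentMap hp hΦ g ⟨y, v⟩)
  have hone := h1
  rw [hG] at hone
  have hCh : C * horLen g p ⟨y, v⟩ ≤ ε := by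
    have h3 : (C + 1) / ε * horLen g p ⟨y, v⟩ ≤ 1 := by
      refine le_of_le_of_eq (Real.le_sqrt_of_sq_le ?_) hone
      nlinarith [sq_nonneg ‖θ y v‖]
    rw [div_mul_eq_mul_div, div_le_one hε] at h3
    linarith
  have e1 : ‖θ y v - Q (θ y v)‖ ≤ C₁ * horLen g p ⟨y, v⟩ := by
    have h3 : θ y v - Q (θ y v) = P (θ y v) - β y v := by
      rw [hv, sub_zero]
      nth_rw 1 [← hPQ (θ y v)]
      abel
    rw [h3]
    exact h₁ y v
  have e2 : ‖θ (Φ y) (mfderiv (𝓡 d) (𝓡 d) Φ y v) - realLin A (Q (θ y v))‖ ≤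
      C₁ * (M * horLen g p ⟨y, v⟩) + C₂ * horLen g p ⟨y, v⟩ := by
    have h3 : θ (Φ y) (mfderiv (𝓡 d) (𝓡 d) Φ y v) - realLin A (Q (θ y v)) =
        (P (θ (Φ y) (mfderiv (𝓡 d) (𝓡 d) Φ y v)) - β (Φ y) (mfderiv (𝓡 d) (𝓡 d) Φ y v)) +
        (Q (θ (Φ y) (mfderiv (𝓡 d) (𝓡 d) Φ y v)) - realLin A (Q (θ y v))) := by
      rw [hβA, hv, map_zero, sub_zero]
      nth_rw 1 [← hPQ (θ (Φ y) (mfderiv (𝓡 d) (𝓡 d) Φ y v))]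
      abel
    rw [h3]
    refine (norm_add_le _ _).trans (add_le_add ?_ (h₂ y v))
    exact (h₁ _ _).trans (by gcongr)
  rw [hG]
  refine sqrt_growth (norm_nonneg _) (norm_nonneg _) (norm_nonneg (Q (θ y v)))
    (norm_nonneg (realLin A (Q (θ y v)))) hh (horLen_nonneg g _) hK hε.le hm hM
    ((abs_norm_sub_norm_le _ _).trans (e1.trans ?_))
    ((abs_norm_sub_norm_le _ _).trans (e2.trans ?_)) (hmA _) (hMA _) hlow hup hone
  · refine le_trans ?_ hCh
    gcongr
    have : 0 ≤ C₁ * M := by positivity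
    simp only [C]
    linarith
  · refine le_trans ?_ hCh
    have : 0 ≤ C₁ * horLen g p ⟨y, v⟩ := by positivity
    simp only [C]
    linarith

lemma exists_slack {μ m M l : ℝ} (hm : 0 ≤ m) (hM : 0 ≤ M) (h1 : μ < m) (h2 : M < l) :
    ∃ ε > 0, μ < m * (1 - ε) - ε ∧ M * (1 + ε) + ε < l := by
  have h3 : 0 < (m - μ) / (m + 1) := div_pos (by linarith) (by linarith)
  have h4 : 0 < (l - M) / (M + 1) := div_pos (by linarith) (by linarith)
  obtain ⟨ε, h0, hε⟩ := exists_between (lt_min h3 h4)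
  rw [lt_min_iff, lt_div_iff₀ (by linarith), lt_div_iff₀ (by linarith)] at hε
  exact ⟨ε, h0, by nlinarith, by nlinarith⟩

/-- Growth rates `m` and `M` on the center directions that lie strictly between the stable and the
unstable rates `μ` and `l`. If `V = ⊥`, the numbers `linMin A V` and `linMax A V` have no meaning,
and the rates `m₀`, `M₀` of the base are used instead. -/
lemma exists_center_rates {V : Submodule ℝ (EuclideanSpace ℝ (Fin k))} {μ l m₀ M₀ : ℝ}
    (hm : V ≠ ⊥ → μ < linMin A V) (hM : V ≠ ⊥ → linMax A V < l) (hm₀ : μ < m₀) (hM₀ : M₀ < l) :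
    ∃ m M : ℝ, μ < m ∧ M < l ∧ m ≤ m₀ ∧ M₀ ≤ M ∧
      ∀ v ∈ V, m * ‖v‖ ≤ ‖realLin A v‖ ∧ ‖realLin A v‖ ≤ M * ‖v‖ := by
  by_cases h : V = ⊥
  · refine ⟨m₀, M₀, hm₀, hM₀, le_rfl, le_rfl, fun v hv => ?_⟩
    rw [h, Submodule.mem_bot] at hv
    simp [hv]
  · refine ⟨min m₀ (linMin A V), max M₀ (linMax A V), lt_min hm₀ (hm h), max_lt hM₀ (hM h),
      min_le_left _ _, le_max_left _ _, fun v hv => ⟨?_, ?_⟩⟩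
    · refine le_trans ?_ (linMin_le_norm_realLin A hv)
      gcongr
      exact min_le_right _ _
    · refine (norm_realLin_le_linMax A hv).trans ?_
      gcongr
      exact le_max_right _ _

omit [IsManifold (𝓡 b) ∞ X] [IsManifold (𝓡 d) ∞ E] in
lemma fiberwise_map (hp : IsPrincipalTorusBundle (k := k) (b := b) (d := d) p) {F : E → E}
    (hF : IsAMap (d := d) A p f F) {V : Submodule ℝ (EuclideanSpace ℝ (Fin k))}
    (hV : V.map (realLin A) = V) : IsInvariantFamily F (fiberwise d (E := E) V) := by
  intro y
  refine le_antisymm ?_ ?_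
  · rintro _ ⟨_, ⟨a, ha, rfl⟩, rfl⟩
    refine ⟨realLin A a, ?_, (hF.mfderiv_orbitDeriv hp y a).symm⟩
    rw [← hV]
    exact Submodule.mem_map_of_mem ha
  · rintro _ ⟨a, ha, rfl⟩
    refine ⟨_, ⟨_, realLin_inv_mem A hV ha, rfl⟩, ?_⟩
    refine (hF.mfderiv_orbitDeriv hp y _).trans ?_
    rw [realLin_apply_inv]

omit [IsManifold (𝓡 d) ∞ E] [MulAction (Torus k) E] in
lemma isInvariantFamily_ker {Φ : E ≃ₘ^∞⟮𝓡 d, 𝓡 d⟯ E} {β : VecForm k d E}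
    (hβA : ∀ y v, β (Φ y) (mfderiv (𝓡 d) (𝓡 d) Φ y v) = realLin A (β y v)) :
    IsInvariantFamily Φ fun y => LinearMap.ker (β y) := by
  intro y
  refine le_antisymm ?_ fun w hw => ?_
  · rintro _ ⟨v, hv, rfl⟩
    refine (hβA y v).trans ?_
    rw [LinearMap.mem_ker.1 hv, map_zero]
  · obtain ⟨v, rfl⟩ := (Φ.mfderivToContinuousLinearEquiv (by simp) y).surjective w
    refine ⟨v, ?_, rfl⟩
    have h1 : realLin A (β y v) = 0 := (hβA y v).symm.trans hw
    change β y v = 0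
    rw [← realLin_inv_apply A (β y v), h1, map_zero]

section Splitting

variable {Es Ec Eu : Submodule ℝ (EuclideanSpace ℝ (Fin k))}
  {Ps Pc Pu : EuclideanSpace ℝ (Fin k) →ₗ[ℝ] EuclideanSpace ℝ (Fin k)}

/-- The projections of an invariant splitting commute with `A`. -/
lemma apply_realLin_of_invariant (hs : Es.map (realLin A) = Es) (hc : Ec.map (realLin A) = Ec)
    (hu : Eu.map (realLin A) = Eu) (hPs : ∀ v, Ps v ∈ Es) (hPc : ∀ v, Pc v ∈ Ec)
    (hPu : ∀ v, Pu v ∈ Eu) (hEs : ∀ v ∈ Es, Ps v = v ∧ Pc v = 0 ∧ Pu v = 0)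
    (hEc : ∀ v ∈ Ec, Ps v = 0 ∧ Pc v = v ∧ Pu v = 0)
    (hEu : ∀ v ∈ Eu, Ps v = 0 ∧ Pc v = 0 ∧ Pu v = v) (hsum : ∀ v, Ps v + Pc v + Pu v = v)
    (v : EuclideanSpace ℝ (Fin k)) :
    Ps (realLin A v) = realLin A (Ps v) ∧ Pc (realLin A v) = realLin A (Pc v) ∧
      Pu (realLin A v) = realLin A (Pu v) := by
  have h1 := hEs _ (hs ▸ Submodule.mem_map_of_mem (hPs v))
  have h2 := hEc _ (hc ▸ Submodule.mem_map_of_mem (hPc v))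
  have h3 := hEu _ (hu ▸ Submodule.mem_map_of_mem (hPu v))
  have h4 : realLin A v = realLin A (Ps v) + realLin A (Pc v) + realLin A (Pu v) := by
    rw [← map_add, ← map_add, hsum]
  rw [h4]
  simp only [map_add, h1, h2, h3]
  simp

variable {T : Type*} [AddCommGroup T] [Module ℝ T] {s : EuclideanSpace ℝ (Fin k) →ₗ[ℝ] T}
  {θ θs θu : T →ₗ[ℝ] EuclideanSpace ℝ (Fin k)} (hθ : ∀ a, θ (s a) = a)
  (hPc : ∀ v, Pc v ∈ Ec) (hEs : ∀ v ∈ Es, Ps v = v ∧ Pc v = 0 ∧ Pu v = 0)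
  (hEc : ∀ v ∈ Ec, Ps v = 0 ∧ Pc v = v ∧ Pu v = 0)
  (hEu : ∀ v ∈ Eu, Ps v = 0 ∧ Pc v = 0 ∧ Pu v = v)
  (hθsV : ∀ v, θs v ∈ Es) (hθuV : ∀ v, θu v ∈ Eu) (hθs : ∀ a, θs (s a) = Ps a)
  (hθu : ∀ a, θu (s a) = Pu a)
include hEs hEu hθsV hθuV

lemma eq_zero_of_add_eq_zero {v : T} (h : (θs + θu) v = 0) : θs v = 0 ∧ θu v = 0 := by
  have h1 := hEs _ (hθsV v)
  have h2 := hEu _ (hθuV v)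
  have h0 : θs v + θu v = 0 := h
  have h3 := congrArg Ps h0
  have h4 := congrArg Pu h0
  simp only [map_add, h1, h2, map_zero, add_zero, zero_add] at h3 h4
  exact ⟨h3, h4⟩

include hθs hθu

/-- Here `s` embeds `ℝᵏ` as the vertical part of a tangent space `T`, and `θs`, `θu` extend the
projections `Ps`, `Pu` to `T`. -/
lemma isSplitting_ker : IsSplitting (Es.map s) (LinearMap.ker (θs + θu)) (Eu.map s) := by
  refine ⟨?_, ?_, ?_⟩
  · rw [Submodule.disjoint_def]
    rintro _ ⟨a, ha, rfl⟩ h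
    have h1 := (eq_zero_of_add_eq_zero hEs hEu hθsV hθuV (LinearMap.mem_ker.1 h)).1
    rw [hθs, (hEs a ha).1] at h1
    rw [h1, map_zero]
  · rw [Submodule.disjoint_def]
    rintro x h ⟨a, ha, hax⟩
    obtain ⟨_, ⟨c, hc, rfl⟩, w, hw, rfl⟩ := Submodule.mem_sup.1 h
    have h1 := (eq_zero_of_add_eq_zero hEs hEu hθsV hθuV (LinearMap.mem_ker.1 hw)).2
    have h2 := congrArg θu hax
    rw [hθu, map_add, hθu, h1, (hEs c hc).2.2, (hEu a ha).2.2, add_zero] at h2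
    rw [← hax, h2, map_zero]
  · rw [codisjoint_iff, eq_top_iff]
    intro v _
    have h1 : v - s (θs v + θu v) ∈ LinearMap.ker (θs + θu) := by
      rw [LinearMap.mem_ker, map_sub]
      change θs v + θu v - (θs (s _) + θu (s _)) = 0
      rw [hθs, hθu, map_add, map_add, (hEs _ (hθsV v)).1, (hEu _ (hθuV v)).1,
        (hEs _ (hθsV v)).2.2, (hEu _ (hθuV v)).2.2]
      abel
    have h2 : v = s (θs v) + (v - s (θs v + θu v)) + s (θu v) := by
      rw [map_add]
      abel
    rw [h2]
    exact Submodule.add_mem_sup (Submodule.add_mem_sup (Submodule.mem_map_of_mem (hθsV v)) h1)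
      (Submodule.mem_map_of_mem (hθuV v))

include hθ hPc hEc

/-- The kernel of `θs + θu` consists of the vertical center directions and a complement to all
vertical directions, namely the kernel of a left inverse of `s`. -/
lemma map_sup_ker : Ec.map s ⊔ LinearMap.ker (θs + θu + Pc ∘ₗ θ) = LinearMap.ker (θs + θu) := by
  refine le_antisymm (sup_le ?_ fun v hv => ?_) fun v hv => ?_
  · rintro _ ⟨a, ha, rfl⟩
    change θs (s a) + θu (s a) = 0
    rw [hθs, hθu, (hEc a ha).1, (hEc a ha).2.2, add_zero]
  · have h0 : θs v + θu v + Pc (θ v) = 0 := hv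
    have h1 := congrArg Pc h0
    rw [map_add, map_add, (hEs _ (hθsV v)).2.1, (hEu _ (hθuV v)).2.1, (hEc _ (hPc _)).2.1,
      map_zero, zero_add, zero_add] at h1
    rw [h1, add_zero] at h0
    exact h0
  · have h1 : v - s (Pc (θ v)) ∈ LinearMap.ker (θs + θu + Pc ∘ₗ θ) := by
      have h0 : θs v + θu v = 0 := hv
      have h2 := hEc _ (hPc (θ v))
      change (θs + θu + Pc ∘ₗ θ) _ = 0
      rw [map_sub]
      change θs v + θu v + Pc (θ v) - (θs (s _) + θu (s _) + Pc (θ (s _))) = 0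
      rw [hθs, hθu, hθ, h2.1, h2.2.1, h2.2.2, h0]
      abel
    have h2 : v = s (Pc (θ v)) + (v - s (Pc (θ v))) := by abel
    rw [h2]
    exact Submodule.add_mem_sup (Submodule.mem_map_of_mem (hPc _)) h1

end Splitting

end

/-! ### Partial hyperbolicity -/

section

variable {k b d : ℕ} {X : Type*} {E : Type*}
  [TopologicalSpace X] [ChartedSpace (EuclideanSpace ℝ (Fin b)) X] [IsManifold (𝓡 b) ∞ X]
  [TopologicalSpace E] [ChartedSpace (EuclideanSpace ℝ (Fin d)) E] [IsManifold (𝓡 d) ∞ E]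
  [MulAction (Torus k) E]

/-- The statement for principal torus bundles over a closed manifold of any positive dimension. -/
theorem IsAMap.exists_isPartiallyHyperbolicFor [NeZero b] [T2Space X] [CompactSpace X] [Nonempty X]
    [T2Space E] {p : E → X} (hp : IsPrincipalTorusBundle (k := k) (b := b) (d := d) p)
    (hd : d = b + k) {f : X ≃ₘ^∞⟮𝓡 b, 𝓡 b⟯ X} {A : Matrix.SpecialLinearGroup (Fin k) ℤ}
    {Φ : E ≃ₘ^∞⟮𝓡 d, 𝓡 d⟯ E} (hΦ : IsAMap (d := d) A p f Φ)
    {Es Ec Eu : Submodule ℝ (EuclideanSpace ℝ (Fin k))} (hsplit : IsSplitting Es Ec Eu)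
    (hs0 : Es ≠ ⊥) (hu0 : Eu ≠ ⊥) (hs : Es.map (realLin A) = Es) (hc : Ec.map (realLin A) = Ec)
    (hu : Eu.map (realLin A) = Eu) (hsc : Ec ≠ ⊥ → linMax A Es < linMin A Ec)
    (hcu : Ec ≠ ⊥ → linMax A Ec < linMin A Eu) {g : Metric b X}
    (hsf : linMax A Es < g.derivMin f) (huf : g.derivMax f < linMin A Eu) :
    ∃ H' : ∀ y : E, Submodule ℝ (TangentSpace (𝓡 d) y), IsSubbundle H' ∧
      (∀ y, IsCompl (vertical b d p y) (H' y)) ∧ (∀ y, Disjoint (fiberwise d Ec y) (H' y)) ∧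
      IsPartiallyHyperbolicFor Φ (fiberwise d Es) (fun y => fiberwise d Ec y ⊔ H' y)
        (fiberwise d Eu) := by
  have := hp.compactSpace
  obtain ⟨Ps, Pc, Pu, hPs, hPc, hPu, hEs, hEc, hEu, hsum⟩ := hsplit.exists_projections
  have hPA := apply_realLin_of_invariant (A := A) hs hc hu hPs hPc hPu hEs hEc hEu hsum
  obtain ⟨θ, hθ, hθ1⟩ := exists_dual_form (n := d) (M := E) (k := k) (fun y => orbitDeriv k y)
    (fun a => (contMDiff_orbitDeriv hp.contMDiff_smul).comp
      (contMDiff_id.prodMk contMDiff_const)) hp.orbitDeriv_injective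
  have hθc : VecForm.IsCont θ := hθ.continuous
  obtain ⟨θs, hθsc, hθsV, hθs, hθsA⟩ :=
    exists_stable_form hp hΦ hd hθc hθ1 hs hPs (fun v => (hPA v).1) hsf
  obtain ⟨θu, hθuc, hθuV, hθu, hθuA⟩ :=
    exists_unstable_form hp hΦ hd hθc hθ1 hu hPu (fun v => (hPA v).2.2) huf
  let β : VecForm k d E := θs + θu
  let θ' : VecForm k d E := β + fun y => Pc ∘ₗ θ y
  have hβA : ∀ y v, β (Φ y) (mfderiv (𝓡 d) (𝓡 d) Φ y v) = realLin A (β y v) := fun y v => by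
    change θs _ _ + θu _ _ = realLin A (θs y v + θu y v)
    rw [hθsA, hθuA, map_add]
  have hβ1 : ∀ y a, β y (orbitDeriv k y a) = (Ps + Pu) a := fun y a => by
    change θs _ _ + θu _ _ = Ps a + Pu a
    rw [hθs, hθu]
  have hθ'1 : IsConnection θ' := fun y a => by
    change β _ _ + Pc (θ y (orbitDeriv k y a)) = a
    rw [hβ1, hθ1]
    change Ps a + Pu a + Pc a = a
    rw [add_right_comm, hsum]
  have hcenter : (fun y => fiberwise d Ec y ⊔ LinearMap.ker (θ' y)) =
      fun y => LinearMap.ker (β y) := funext fun y =>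
    map_sup_ker (hθ1 y) hPc hEs hEc hEu (hθsV y) (hθuV y) (hθs y) (hθu y)
  have hvert : ∀ y, IsCompl (vertical b d p y) (LinearMap.ker (θ' y)) := fun y => by
    rw [← hp.range_orbitDeriv hd y]
    refine ⟨?_, ?_⟩
    · rw [Submodule.disjoint_def]
      rintro _ ⟨a, rfl⟩ h
      rw [← hθ'1 y a, LinearMap.mem_ker.1 h, map_zero]
    · rw [codisjoint_iff, eq_top_iff]
      intro v _
      have h1 : v - orbitDeriv k y (θ' y v) ∈ LinearMap.ker (θ' y) := by
        rw [LinearMap.mem_ker, map_sub, hθ'1, sub_self]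
      have h2 : v = orbitDeriv k y (θ' y v) + (v - orbitDeriv k y (θ' y v)) := by abel
      rw [h2]
      exact Submodule.add_mem_sup ⟨_, rfl⟩ h1
  have hθ'c : VecForm.IsCont θ' := (hθsc.add hθuc).add (hθc.comp Pc)
  refine ⟨fun y => LinearMap.ker (θ' y), isSubbundle_ker hp hθ'c (R := ⊤) (fun _ _ => trivial)
    fun y a _ => hθ'1 y a, hvert, fun y => (hvert y).disjoint.mono_left ?_, ?_⟩
  · rw [← hp.range_orbitDeriv hd y]
    exact LinearMap.map_le_range
  rw [hcenter]
  have hbot : ∀ {V : Submodule ℝ (EuclideanSpace ℝ (Fin k))}, V ≠ ⊥ →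
      ∀ y : E, fiberwise d V y ≠ ⊥ := fun h0 y h =>
    h0 (Submodule.map_injective_of_injective (hp.orbitDeriv_injective y)
      (h.trans (Submodule.map_bot _).symm))
  have hms := linMax_nonneg A Es
  obtain ⟨m, M, hm, hM, hmf, hMf, hmM⟩ := exists_center_rates (A := A) hsc hcu hsf huf
  have hM0 : 0 ≤ M := (g.derivMax_nonneg f).trans hMf
  obtain ⟨ε, hε, hεm, hεM⟩ := exists_slack (hms.trans hm.le) hM0 hm hM
  obtain ⟨G, hG, hGc⟩ := exists_metric_center hp hd hΦ g hθ hθ1 (hθsc.add hθuc)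
    (P := Ps + Pu) (Q := Pc) (fun v => by
      change Ps v + Pu v + Pc v = v
      rw [add_right_comm, hsum]) (fun v => (hPA v).2.1) hβ1 hβA (hms.trans hm.le) hmf hMf
    (fun v => (hmM _ (hPc v)).1) (fun v => (hmM _ (hPc v)).2) hε
  have hGs : ∀ y, ∀ v ∈ fiberwise d Es y, G.len v = 1 →
      G.len (mfderiv (𝓡 d) (𝓡 d) Φ y v) ≤ linMax A Es := by
    rintro y _ ⟨a, ha, rfl⟩ h1
    rw [hG] at h1
    rw [hΦ.mfderiv_orbitDeriv hp, hG]
    simpa [h1] using norm_realLin_le_linMax A ha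
  have hGu : ∀ y, ∀ v ∈ fiberwise d Eu y, G.len v = 1 →
      linMin A Eu ≤ G.len (mfderiv (𝓡 d) (𝓡 d) Φ y v) := by
    rintro y _ ⟨a, ha, rfl⟩ h1
    rw [hG] at h1
    rw [hΦ.mfderiv_orbitDeriv hp, hG]
    simpa [h1] using linMin_le_norm_realLin A ha
  -- `f` neither contracts nor expands the closed manifold `X` uniformly
  have h1s : linMax A Es < 1 := hsf.trans_le (g.derivMin_le_one f)
  have h1u : 1 < linMin A Eu := (g.one_le_derivMax f).trans_lt huf
  obtain ⟨r, hr, hr1⟩ := exists_between (max_lt h1s (inv_lt_one_of_one_lt₀ h1u))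
  rw [max_lt_iff] at hr
  have hr0 : 0 < r := hms.trans_lt hr.1
  exact
    { subbundle_s := isSubbundle_fiberwise hp hθc hθ1 hPs fun v hv => (hEs v hv).1
      subbundle_c := isSubbundle_ker hp (hθsc.add hθuc) (R := Es ⊔ Eu)
        (fun y v => Submodule.add_mem_sup (hθsV y v) (hθuV y v)) fun y a ha => by
          obtain ⟨v, hv, w, hw, rfl⟩ := Submodule.mem_sup.1 ha
          rw [hβ1, map_add]
          change Ps v + Pu v + (Ps w + Pu w) = v + w
          rw [(hEs v hv).1, (hEs v hv).2.2, (hEu w hw).1, (hEu w hw).2.2, add_zero, zero_add]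
      subbundle_u := isSubbundle_fiberwise hp hθc hθ1 hPu fun v hv => (hEu v hv).2.2
      splitting := fun y =>
        isSplitting_ker hEs hEu (hθsV y) (hθuV y) (hθs y) (hθu y)
      nonzero_s := hbot hs0
      nonzero_u := hbot hu0
      invariant_s := fiberwise_map hp hΦ hs
      invariant_c := isInvariantFamily_ker hβA
      invariant_u := fiberwise_map hp hΦ hu
      domination := by
        refine ⟨r⁻¹, G, (one_lt_inv₀ hr0).2 hr1, fun y v hv h1 => ?_, fun x y v hv w hw h1 h2 => ?_,
          fun x y v hv w hw h1 h2 => ?_, fun y v hv h1 => ?_⟩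
        · rw [inv_inv]
          exact (hGs y v hv h1).trans hr.1.le
        · exact (hGs x v hv h1).trans_lt (hεm.trans_le (hGc y w hw h2).1)
        · exact ((hGc x v hv h1).2.trans_lt hεM).trans_le (hGu y w hw h2)
        · exact (inv_lt_of_inv_lt₀ (by linarith) hr.2).le.trans (hGu y v hv h1) }

end

end TorusExt

end

theorem theorem7p1 {k : ℕ}
    {X : Type*} [TopologicalSpace X] [ChartedSpace (EuclideanSpace ℝ (Fin 4)) X]
    [IsManifold (𝓡 4) ∞ X] [T2Space X] [CompactSpace X] [SimplyConnectedSpace X]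
    {E : Type*} [TopologicalSpace E] [ChartedSpace (EuclideanSpace ℝ (Fin (4 + k))) E]
    [IsManifold (𝓡 (4 + k)) ∞ E] [T2Space E] [MulAction (TorusExt.Torus k) E]
    (f : X ≃ₘ^∞⟮𝓡 4, 𝓡 4⟯ X) (A : Matrix.SpecialLinearGroup (Fin k) ℤ)
    (Es Ec Eu : Submodule ℝ (EuclideanSpace ℝ (Fin k)))
    (hf : TorusExt.BaseAssumptions f A Es Ec Eu)
    (p : E → X)
    (hp : TorusExt.IsPrincipalTorusBundle (k := k) (b := 4) (d := 4 + k) p)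
    (F : E → E)
    (hF : TorusExt.IsAMap (d := 4 + k) A p f F) :
    ∃ Φ : E ≃ₘ^∞⟮𝓡 (4 + k), 𝓡 (4 + k)⟯ E, (∀ y, Φ y = F y) ∧
      TorusExt.IsPartiallyHyperbolic Φ ∧
      ∃ H' : ∀ y : E, Submodule ℝ (TangentSpace (𝓡 (4 + k)) y),
        TorusExt.IsSubbundle H' ∧
        (∀ y, IsCompl (TorusExt.vertical 4 (4 + k) p y) (H' y)) ∧
        (∀ y, Disjoint (TorusExt.fiberwise (4 + k) Ec y) (H' y)) ∧
        TorusExt.IsPartiallyHyperbolicFor Φ (TorusExt.fiberwise (4 + k) Es)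
          (fun y => TorusExt.fiberwise (4 + k) Ec y ⊔ H' y)
          (TorusExt.fiberwise (4 + k) Eu) := by
  obtain ⟨Φ, hΦ⟩ := hF.exists_diffeomorph hp rfl
  obtain rfl : F = Φ := funext fun y => (hΦ y).symm
  obtain ⟨g, hsf, huf⟩ := hf.domination
  obtain ⟨x, -⟩ := hf.pi_two
  have : Nonempty X := ⟨x⟩
  obtain ⟨H', h1, h2, h3, h4⟩ := hF.exists_isPartiallyHyperbolicFor hp rfl hf.splitting hf.nonzero_s
    hf.nonzero_u hf.invariant_s hf.invariant_c hf.invariant_u hf.s_lt_c hf.c_lt_u hsf huf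
  exact ⟨Φ, hΦ, ⟨_, _, _, h4⟩, H', h1, h2, h3, h4⟩
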